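/- Let $(V,Y,\mathbf 1,\omega)$ be a vertex operator algebra over $\mathbb C$: $V=\bigoplus_{n\in\mathbb Z}V_n$ with $\dim V_n<\infty$ and $V_n=0$ for $n$ sufficiently small, $Y(u,z)=\sum_{n\in\mathbb Z}u_nz^{-n-1}$, $L(n)=\omega_{n+1}$, and $L(0)$ acts on $V_n$ as $n$; for $u\in V_n$ write $\mathrm{wt}\,u=n$. Let $g$ be an automorphism of $V$ of finite order $T$ (a linear automorphism with $gY(u,z)g^{-1}=Y(gu,z)$, $g\mathbf 1=\mathbf 1$, $g\omega=\omega$), and for $0\le r<T$ let $V^r=\{v\in V: gv=e^{2\pi i r/T}v\}$. Put $\delta_0=1$ and $\delta_r=0$ for $r\neq0$. For homogeneous $u\in V^r$ and for $v\in V$ define $$u\circ_g v=\mathrm{Res}_z\frac{(1+z)^{\mathrm{wt}\,u-1+\delta_r+r/T}}{z^{1+\delta_r}}Y(u,z)v,\qquad u*_gv=\begin{cases}\mathrm{Res}_z\dfrac{(1+z)^{\mathrm{wt}\,u}}{z}Y(u,z)v & r=0,\\[2mm] 0 & r>0,\end{cases}$$ where powers of $1+z$ are expanded in nonnegative powers of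 $z$, and extend $*_g$ linearly in $u$ to a bilinear product on $V$. Let $O_g(V)$ be the linear span of all $u\circ_gv$ and let $A_g(V)=V/O_g(V)$. Define $O_{g^{-1}}(V)$, $*_{g^{-1}}$ and $A_{g^{-1}}(V)$ in the same way from $g^{-1}$. (i) The product $*_g$ induces a well-defined bilinear associative product on $A_g(V)$ (and, likewise, $*_{g^{-1}}$ on $A_{g^{-1}}(V)$). (ii) The linear map $\phi:V\to V$, $\phi(a)=e^{L(1)}(-1)^{L(0)}a$, induces an anti-isomorphism $A_g(V)\to A_{g^{-1}}(V)$, that is, a linear bijection $\Phi$ with $\Phi(a+O_g(V))=\phi(a)+O_{g^{-1}}(V)$ for all $a\in V$ and $\Phi(xy)=\Phi(y)\Phi(x)$ for all $x,y\in A_g(V)$. (iii) For all $x\in V$, $$\mathbf 1*_gx\equiv x*_g\mathbf 1\equiv x \pmod{O_g(V)},\qquad \omega*_gx\equiv x*_g\omega\pmod{O_g(V)}.$$ -/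

import Mathlib

noncomputable section

/-- The mode `u_n` of the vertex operator `Y(u,z) = ∑_n u_n z^{-n-1}`. -/
abbrev vertexMode {V : Type*} [AddCommGroup V] [Module ℂ V]
    (Y : V →ₗ[ℂ] VertexOperator ℂ V) (u : V) (n : ℤ) : Module.End ℂ V :=
  VertexOperator.ncoeff (Y u) n

/-- A vertex operator algebra `(V, Y, 𝟏, ω)` over `ℂ`, graded by the integers, in the sense of
Frenkel-Lepowsky-Meurman and Frenkel-Huang-Lepowsky.  That `Y(u,z)v` is a Laurent series in `z`
with finitely many negative powers is part of the type `VertexOperator ℂ V`. -/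
structure VertexOperatorAlgebra (V : Type*) [AddCommGroup V] [Module ℂ V] where
  /-- the homogeneous subspaces `V_n` -/
  wt : ℤ → Submodule ℂ V
  /-- the state-field correspondence `u ↦ Y(u,z)` -/
  Y : V →ₗ[ℂ] VertexOperator ℂ V
  /-- the vacuum vector `𝟏` -/
  vacuum : V
  /-- the Virasoro vector `ω` -/
  omega : V
  /-- the central charge (rank) -/
  centralCharge : ℂ
  /-- `V = ⨁ V_n` -/
  isInternal : DirectSum.IsInternal wt
  finiteDimensional : ∀ n, FiniteDimensional ℂ (wt n)
  /-- `V_n = 0` for `n` sufficiently small -/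
  bounded_below : ∃ N : ℤ, ∀ n < N, wt n = ⊥
  vacuum_mem : vacuum ∈ wt 0
  omega_mem : omega ∈ wt 2
  /-- `Y(𝟏,z) = id` -/
  vacuum_mode : ∀ (n : ℤ) (v : V), vertexMode Y vacuum n v = if n = -1 then v else 0
  /-- `Y(u,z)𝟏` has no negative powers of `z` -/
  creation_nonneg : ∀ (u : V) (n : ℤ), 0 ≤ n → vertexMode Y u n vacuum = 0
  /-- the constant term of `Y(u,z)𝟏` is `u` -/
  creation : ∀ u : V, vertexMode Y u (-1) vacuum = u
  /-- The Jacobi identity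
  `z₀⁻¹δ((z₁-z₂)/z₀) Y(u,z₁)Y(v,z₂)w - z₀⁻¹δ((z₂-z₁)/(-z₀)) Y(v,z₂)Y(u,z₁)w
    = z₂⁻¹δ((z₁-z₀)/z₂) Y(Y(u,z₀)v,z₂)w`, written out as the equality of the coefficients of
  `z₀^{-l-1} z₁^{-m-1} z₂^{-n-1}` on both sides.  All three sums have finitely many
  nonzero terms. -/
  jacobi : ∀ (u v w : V) (l m n : ℤ),
    (∑ᶠ i : ℕ, ((-1 : ℤ) ^ i * Ring.choose l i) •
        vertexMode Y u (m + l - i) (vertexMode Y v (n + i) w)) -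
      (Int.negOnePow l : ℤ) • (∑ᶠ i : ℕ, ((-1 : ℤ) ^ i * Ring.choose l i) •
        vertexMode Y v (n + l - i) (vertexMode Y u (m + i) w)) =
    ∑ᶠ i : ℕ, (Ring.choose m i) •
        vertexMode Y (vertexMode Y u (l + i) v) (m + n - i) w
  /-- The Virasoro relations for `L(n) = ω_{n+1}` -/
  virasoro : ∀ (m n : ℤ) (v : V),
    vertexMode Y omega (m + 1) (vertexMode Y omega (n + 1) v) -
      vertexMode Y omega (n + 1) (vertexMode Y omega (m + 1) v) =
    ((m : ℂ) - n) • vertexMode Y omega (m + n + 1) v +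
      (if m + n = 0 then (((m : ℂ) ^ 3 - m) / 12 * centralCharge) • v else 0)
  /-- `L(0) v = n v` for `v ∈ V_n` -/
  L_zero : ∀ (n : ℤ) (v : V), v ∈ wt n → vertexMode Y omega 1 v = (n : ℂ) • v
  /-- `Y(L(-1)u,z) = d/dz Y(u,z)` -/
  L_neg_one : ∀ (u : V) (n : ℤ),
    vertexMode Y (vertexMode Y omega 0 u) n = (-(n : ℂ)) • vertexMode Y u (n - 1)

namespace VertexOperatorAlgebra

variable {V : Type*} [AddCommGroup V] [Module ℂ V] (A : VertexOperatorAlgebra V)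

/-- The mode `u_n` of `Y(u,z) = ∑_n u_n z^{-n-1}`. -/
abbrev mode (u : V) (n : ℤ) : Module.End ℂ V := vertexMode A.Y u n

/-- The Virasoro operator `L(n) = ω_{n+1}`. -/
def L (n : ℤ) : Module.End ℂ V := A.mode A.omega (n + 1)

/-- The automorphism group of `V`: the linear automorphisms `g` with
`g Y(u,z) v = Y(g u,z) g v`, `g 𝟏 = 𝟏` and `g ω = ω`. -/
def Aut : Subgroup (V ≃ₗ[ℂ] V) where
  carrier := {g | (∀ (u v : V) (n : ℤ), g (A.mode u n v) = A.mode (g u) n (g v)) ∧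
    g A.vacuum = A.vacuum ∧ g A.omega = A.omega}
  mul_mem' := by
    rintro a b ⟨ha, ha1, ha2⟩ ⟨hb, hb1, hb2⟩
    refine ⟨fun u v n => ?_, ?_, ?_⟩
    · simp only [LinearEquiv.mul_apply, hb, ha]
    · simp only [LinearEquiv.mul_apply, hb1, ha1]
    · simp only [LinearEquiv.mul_apply, hb2, ha2]
  one_mem' := ⟨fun _ _ _ => rfl, rfl, rfl⟩
  inv_mem' := by
    rintro a ⟨ha, ha1, ha2⟩
    have key : ∀ x, a (a⁻¹ x) = x := fun x => a.apply_symm_apply x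
    refine ⟨fun u v n => ?_, ?_, ?_⟩
    · apply a.injective
      rw [ha, key, key, key]
    · apply a.injective
      rw [key, ha1]
    · apply a.injective
      rw [key, ha2]

theorem mode_add (u u' : V) (n : ℤ) : A.mode (u + u') n = A.mode u n + A.mode u' n := by
  simp only [mode, vertexMode, map_add, Pi.add_apply]

theorem mode_smul (c : ℂ) (u : V) (n : ℤ) : A.mode (c • u) n = c • A.mode u n := by
  simp only [mode, vertexMode, map_smul, Pi.smul_apply]

theorem mode_eventually_zero (u v : V) : ∃ N : ℤ, ∀ n, N ≤ n → A.mode u n v = 0 :=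
  ⟨-((HahnModule.of ℂ).symm (A.Y u v)).order, fun n hn =>
    VertexOperator.ncoeff_eq_zero_of_lt_order (A.Y u) n v (by lia)⟩

theorem residue_finite (α : ℂ) (k : ℤ) (u v : V) :
    (Function.support fun i : ℕ => Ring.choose α i • A.mode u (k + i) v).Finite := by
  obtain ⟨N, hN⟩ := A.mode_eventually_zero u v
  refine (Set.finite_Iio (N - k).toNat).subset fun i hi => ?_
  by_contra h
  apply hi
  simp only [Set.mem_Iio, not_lt] at h
  simp only [hN (k + i) (by lia), smul_zero]

/-- `Res_z (1+z)^α z^k Y(u,z)v = ∑_{i ≥ 0} (α choose i) u_{k+i} v`, where `(1+z)^α` is expanded in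
nonnegative powers of `z`; a finite sum, bilinear in `u` and `v`. -/
def residue (α : ℂ) (k : ℤ) : V →ₗ[ℂ] V →ₗ[ℂ] V :=
  LinearMap.mk₂ ℂ (fun u v => ∑ᶠ i : ℕ, Ring.choose α i • A.mode u (k + i) v)
    (fun u u' v => by
      rw [← finsum_add_distrib (A.residue_finite α k u v) (A.residue_finite α k u' v)]
      exact finsum_congr fun i => by rw [mode_add, LinearMap.add_apply, smul_add])
    (fun c u v => by
      rw [smul_finsum]
      exact finsum_congr fun i => by rw [mode_smul, LinearMap.smul_apply, smul_comm])
    (fun u v v' => by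
      rw [← finsum_add_distrib (A.residue_finite α k u v) (A.residue_finite α k u v')]
      simp)
    (fun c u v => by
      rw [smul_finsum]
      exact finsum_congr fun i => by simp [smul_comm c])

theorem residue_apply (α : ℂ) (k : ℤ) (u v : V) :
    A.residue α k u v = ∑ᶠ i : ℕ, Ring.choose α i • A.mode u (k + i) v := rfl

theorem bijective_coeLinearMap : Function.Bijective (DirectSum.coeLinearMap A.wt) :=
  A.isInternal

/-- The linear map on `V = ⨁ V_n` which agrees with `f n` on `V_n`. -/
def extendByWeight {W : Type*} [AddCommGroup W] [Module ℂ W] (f : ℤ → V →ₗ[ℂ] W) : V →ₗ[ℂ] W :=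
  DirectSum.toModule ℂ ℤ W (fun n => f n ∘ₗ (A.wt n).subtype) ∘ₗ
    (LinearEquiv.ofBijective (DirectSum.coeLinearMap A.wt) A.bijective_coeLinearMap).symm.toLinearMap

theorem extendByWeight_apply {W : Type*} [AddCommGroup W] [Module ℂ W] (f : ℤ → V →ₗ[ℂ] W)
    {n : ℤ} {v : V} (hv : v ∈ A.wt n) : A.extendByWeight f v = f n v := by
  have h : (LinearEquiv.ofBijective (DirectSum.coeLinearMap A.wt) A.bijective_coeLinearMap).symm v =
      DirectSum.lof ℂ ℤ (fun n => A.wt n) n ⟨v, hv⟩ := by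
    rw [LinearEquiv.symm_apply_eq]
    simp
  simp [extendByWeight, h]

/-- The eigenspace `V^r = {v | g v = e^{2πir/T} v}`, where `T` is the order of `g`. -/
def eigen (g : A.Aut) (r : ℕ) : Submodule ℂ V :=
  Module.End.eigenspace (g.1 : V →ₗ[ℂ] V)
    (Complex.exp (2 * Real.pi * Complex.I * r / orderOf g))

/-- `u ∘_g v = Res_z (1+z)^{n-1+δ_r+r/T} z^{-1-δ_r} Y(u,z)v` for `u ∈ V^r` of weight `n`
(`0 ≤ r < T`), where `δ_r` is `1` if `r = 0` and `0` otherwise. -/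
def circ (g : A.Aut) (n : ℤ) (r : ℕ) (u v : V) : V :=
  A.residue (n - 1 + (if r = 0 then 1 else 0) + r / orderOf g) (-1 - (if r = 0 then 1 else 0)) u v

/-- `O_g(V)`: the linear span of all `u ∘_g v`, with `u ∈ V^r` homogeneous and `v ∈ V`. -/
def Og (g : A.Aut) : Submodule ℂ V :=
  Submodule.span ℂ {x | ∃ (n : ℤ) (r : ℕ) (u v : V),
    r < orderOf g ∧ u ∈ A.wt n ∧ u ∈ A.eigen g r ∧ x = A.circ g n r u v}

/-- The quotient space `A_g(V) = V / O_g(V)`. -/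
abbrev Ag (g : A.Aut) : Type _ := V ⧸ A.Og g

/-- The projection of `V = ⨁_r V^r` onto the fixed space `V^0`, obtained by averaging over the
cyclic group generated by `g`. -/
def projFixed (g : A.Aut) : V →ₗ[ℂ] V :=
  (orderOf g : ℂ)⁻¹ • ∑ k ∈ Finset.range (orderOf g), ((g.1 ^ k : V ≃ₗ[ℂ] V) : V →ₗ[ℂ] V)

/-- The bilinear product `*_g` on `V`: for `u ∈ V^r` of weight `n` it is given by
`u *_g v = Res_z (1+z)^n z^{-1} Y(u,z)v` if `r = 0` and `u *_g v = 0` if `0 < r < T`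
(see `star_apply_zero` and `star_apply_pos`), and it is extended linearly in `u`. -/
def star (g : A.Aut) : V →ₗ[ℂ] V →ₗ[ℂ] V :=
  A.extendByWeight (fun n => A.residue n (-1)) ∘ₗ A.projFixed g

theorem pow_apply_of_mem_eigen (g : A.Aut) {r : ℕ} {u : V} (hu : u ∈ A.eigen g r) (k : ℕ) :
    (g.1 ^ k : V ≃ₗ[ℂ] V) u =
      (Complex.exp (2 * Real.pi * Complex.I * r / orderOf g)) ^ k • u := by
  induction k with
  | zero => simp
  | succ k ih =>
    have h : g.1 u = Complex.exp (2 * Real.pi * Complex.I * r / orderOf g) • u :=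
      Module.End.mem_eigenspace_iff.1 hu
    rw [pow_succ, LinearEquiv.mul_apply, h, map_smul, ih, smul_smul, pow_succ, mul_comm]

theorem star_apply_zero (g : A.Aut) (hg : IsOfFinOrder g) {n : ℤ} {u : V} (hn : u ∈ A.wt n)
    (hu : u ∈ A.eigen g 0) (v : V) :
    A.star g u v = ∑ᶠ i : ℕ, Ring.choose (n : ℂ) i • A.mode u (-1 + i) v := by
  have hT : (orderOf g : ℂ) ≠ 0 := by exact_mod_cast hg.orderOf_pos.ne'
  have h : A.projFixed g u = u := by
    simp only [projFixed, LinearMap.smul_apply, LinearMap.sum_apply, LinearEquiv.coe_coe,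
      A.pow_apply_of_mem_eigen g hu]
    simp [← Nat.cast_smul_eq_nsmul ℂ, smul_smul, hT]
  rw [star, LinearMap.comp_apply, h, A.extendByWeight_apply _ hn, residue_apply]

theorem star_apply_pos (g : A.Aut) {r : ℕ} (h0 : 0 < r) (hr : r < orderOf g)
    {u : V} (hu : u ∈ A.eigen g r) (v : V) : A.star g u v = 0 := by
  have hprim := (Complex.isPrimitiveRoot_exp (orderOf g) (by lia)).pow_eq_one
  have hT : (orderOf g : ℂ) ≠ 0 := by
    have : orderOf g ≠ 0 := by lia
    exact_mod_cast this
  have hz : Complex.exp (2 * Real.pi * Complex.I * r / orderOf g) =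
      Complex.exp (2 * Real.pi * Complex.I / orderOf g) ^ r := by
    rw [← Complex.exp_nat_mul]
    congr 1
    ring
  have hne : Complex.exp (2 * Real.pi * Complex.I * r / orderOf g) ≠ 1 := by
    rw [hz]
    exact (Complex.isPrimitiveRoot_exp (orderOf g) (by lia)).pow_ne_one_of_pos_of_lt h0.ne' hr
  have h : A.projFixed g u = 0 := by
    simp only [projFixed, LinearMap.smul_apply, LinearMap.sum_apply, LinearEquiv.coe_coe,
      A.pow_apply_of_mem_eigen g hu]
    rw [← Finset.sum_smul, geom_sum_eq hne, hz, ← pow_mul, mul_comm r, pow_mul, hprim]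
    simp
  rw [star, LinearMap.comp_apply, h]
  simp

/-- A homogeneous space is the whole eigenspace of `L(0)`. -/
theorem mem_wt_of_L_zero {n : ℤ} {v : V} (h : A.L 0 v = (n : ℂ) • v) : v ∈ A.wt n := by
  classical
  let _ := A.isInternal.chooseDecomposition
  have hsum := DirectSum.sum_support_decompose A.wt v
  have hL : ∀ m : ℤ, (DirectSum.decompose A.wt (A.L 0 v) m : V) =
      (m : ℂ) • (DirectSum.decompose A.wt v m : V) := by
    intro m
    have key : ∀ x : V, (DirectSum.decompose A.wt (A.L 0 x) m : V) =
      (m : ℂ) • (DirectSum.decompose A.wt x m : V) := by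
      intro x
      induction x using DirectSum.Decomposition.inductionOn A.wt with
      | zero => simp
      | @homogeneous i a =>
        have ha : A.L 0 (a : V) = (i : ℂ) • (a : V) := A.L_zero i a a.2
        rw [ha, DirectSum.decompose_smul, DirectSum.smul_apply, Submodule.coe_smul]
        by_cases him : i = m
        · subst him
          rfl
        · rw [DirectSum.decompose_of_mem_ne A.wt a.2 him]
          simp
      | add a b ha hb =>
        simp only [map_add, DirectSum.decompose_add, DirectSum.add_apply, Submodule.coe_add,
          ha, hb, smul_add]
    exact key v
  have hz : ∀ m : ℤ, m ≠ n → (DirectSum.decompose A.wt v m : V) = 0 := by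
    intro m hm
    have h1 := hL m
    rw [h, DirectSum.decompose_smul, DirectSum.smul_apply, Submodule.coe_smul, ← sub_eq_zero,
      ← sub_smul, smul_eq_zero, sub_eq_zero] at h1
    rcases h1 with h1 | h1
    · exact absurd (by exact_mod_cast h1.symm) hm
    · exact h1
  rw [← hsum]
  refine Submodule.sum_mem _ fun i _ => ?_
  by_cases hi : i = n
  · rw [← hi]
    exact (DirectSum.decompose A.wt v i).2
  · rw [hz i hi]
    exact Submodule.zero_mem _

theorem L_one_pow_mem {n : ℤ} {v : V} (hv : v ∈ A.wt n) (j : ℕ) :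
    (A.L 1 ^ j) v ∈ A.wt (n - j) := by
  induction j with
  | zero => simpa using hv
  | succ j ih =>
    rw [pow_succ', Module.End.mul_apply]
    set x := (A.L 1 ^ j) v
    apply A.mem_wt_of_L_zero
    have h1 := A.virasoro 0 1 x
    have h0 : vertexMode A.Y A.omega (0 + 1) x = ((n - j : ℤ) : ℂ) • x := A.L_zero _ x ih
    rw [h0, map_smul, sub_eq_iff_eq_add] at h1
    change A.L 0 (A.L 1 x) = _ at h1
    rw [h1]
    change ((0 : ℤ) - (1 : ℤ) : ℂ) • A.L 1 x + _ + _ • A.L 1 x = _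
    rw [if_neg (by lia), add_zero, ← add_smul]
    congr 1
    push_cast
    ring

/-- `L(1)` is locally nilpotent. -/
theorem L_one_locally_nilpotent (v : V) : ∃ N : ℕ, ∀ j, N ≤ j → (A.L 1 ^ j) v = 0 := by
  have hv : v ∈ ⨆ n, A.wt n := by
    rw [A.isInternal.submodule_iSup_eq_top]
    trivial
  obtain ⟨M, hM⟩ := A.bounded_below
  induction hv using Submodule.iSup_induction' with
  | mem n x hx =>
    refine ⟨(n - M + 1).toNat, fun j hj => ?_⟩
    have := A.L_one_pow_mem hx j
    rw [hM _ (by lia)] at this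
    simpa using this
  | zero => exact ⟨0, fun j _ => map_zero _⟩
  | add x y _ _ hx hy =>
    obtain ⟨N, hN⟩ := hx
    obtain ⟨N', hN'⟩ := hy
    refine ⟨max N N', fun j hj => ?_⟩
    rw [map_add, hN j (by lia), hN' j (by lia), add_zero]

theorem exp_finite (v : V) :
    (Function.support fun j : ℕ => ((j.factorial : ℂ)⁻¹) • (A.L 1 ^ j) v).Finite := by
  obtain ⟨N, hN⟩ := A.L_one_locally_nilpotent v
  refine (Set.finite_Iio N).subset fun j hj => ?_
  by_contra h
  apply hj
  simp only [Set.mem_Iio, not_lt] at h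
  simp only [hN j h, smul_zero]

/-- `e^{L(1)} = ∑_j L(1)^j / j!`, a finite sum on each vector. -/
def expL : Module.End ℂ V where
  toFun v := ∑ᶠ j : ℕ, ((j.factorial : ℂ)⁻¹) • (A.L 1 ^ j) v
  map_add' v w := by
    rw [← finsum_add_distrib (A.exp_finite v) (A.exp_finite w)]
    simp
  map_smul' c v := by
    rw [RingHom.id_apply, smul_finsum]
    exact finsum_congr fun j => by rw [map_smul, smul_comm]

/-- `(-1)^{L(0)}`: multiplication by `(-1)^n` on `V_n`. -/
def signL : Module.End ℂ V :=
  A.extendByWeight fun n => ((-1 : ℂ) ^ n) • LinearMap.id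

/-- The linear map `φ(a) = e^{L(1)} (-1)^{L(0)} a` on `V`. -/
def phi : Module.End ℂ V := A.expL ∘ₗ A.signL

end VertexOperatorAlgebra

end

/-! Write `Res(α, k, u) v` for `A.residue α k u v`. Everything follows from the Jacobi identity
paired with `(1+z₁)^α z₁^m (1+z₂)^β z₂^n (z₁-z₂)^l` (`residue_jacobi`): `l = 0` gives a commutator
formula, `m = 0` an iterate formula.

Since `Y(L(-1)u,z)` is a derivative, integration by parts shows that `O_g(V)` contains, besides each
`u ∘_g v`, all residues with a pole deeper by `m` and an exponent of `1+z` larger by `j ≤ m`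
(`residue_mem_Og`). In particular `V^r ⊆ O_g(V)` for `0 < r < T`. With the commutator formula this
makes `O_g(V)` a right-hand ideal for `*_g`, with the iterate formula a left-hand one. The iterate
formula also gives associativity: all its terms except `a * (b * c)` have poles deep enough to lie
in `O_g(V)`.

On `V^0`, `w ∘_g 𝟏 = L(-1)w + (wt w) w`, so modulo `O_g(V)` the series `Y(w,z)𝟏 = e^{zL(-1)}w` acts
like `(1+z)^{-wt w} w`. Applying the commutator formula to `𝟏` yields `a * b - b * a ≡ Res(wt a - 1,
0, a) b`, hence `Res(wt a - 1, -1, a) b ≡ b * a`. For `a = ω` the commutator is `L(-1)b + L(0)b`,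
which is in `O_g(V)`.

Conjugating by `e^{L(1)}(-1)^{L(0)}` sends the exponent `α` at `z^m` to `2 wt a - j - m - 2 - α` for
`L(1)^j a` (`phi_residue`). This turns `∘_g` on `V^r` into `∘_{g⁻¹}` on `V^{T-r}`, and turns `a * b`
into residues of the form `Res(wt - 1, -1, ·) φ(b)`, which are congruent to products with `φ(b)` on
the left. Since `φ² = 1`, the induced map is bijective. -/

noncomputable section

open Finset.HasAntidiagonal (antidiagonal mem_antidiagonal)

/-! ### Rearranging finitely supported sums. -/

theorem finsum_eq_sum_range {M : Type*} [AddCommMonoid M] {f : ℕ → M} {N : ℕ}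
    (h : ∀ i, N ≤ i → f i = 0) : ∑ᶠ i, f i = ∑ i ∈ Finset.range N, f i := by
  refine finsum_eq_sum_of_support_subset f fun i hi => ?_
  by_contra hN
  exact hi (h i (by simpa using hN))

/-- A bound uniform in both indices is required: `∑ᶠ` takes the value `0` on infinite support, so
finiteness of the inner sums alone would not justify the exchange. -/
theorem finsum_comm_of_bound {M : Type*} [AddCommMonoid M] {f : ℕ → ℕ → M} {N : ℕ}
    (h : ∀ i j, N ≤ i ∨ N ≤ j → f i j = 0) :
    ∑ᶠ i, ∑ᶠ j, f i j = ∑ᶠ j, ∑ᶠ i, f i j := by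
  rw [finsum_eq_sum_range (N := N), finsum_eq_sum_range (N := N)]
  · rw [Finset.sum_congr rfl fun i _ => finsum_eq_sum_range (N := N) fun j hj => h i j (.inr hj),
      Finset.sum_congr rfl fun j _ => finsum_eq_sum_range (N := N) fun i hi => h i j (.inl hi),
      Finset.sum_comm]
  · intro j hj
    exact finsum_eq_zero_of_forall_eq_zero fun i => h i j (.inr hj)
  · intro i hi
    exact finsum_eq_zero_of_forall_eq_zero fun j => h i j (.inl hi)

theorem finsum_rotate_of_bound {M : Type*} [AddCommMonoid M] {f : ℕ → ℕ → ℕ → M} {N : ℕ}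
    (h : ∀ i j k, N ≤ i ∨ N ≤ j ∨ N ≤ k → f i j k = 0) :
    ∑ᶠ i, ∑ᶠ j, ∑ᶠ k, f i j k = ∑ᶠ k, ∑ᶠ i, ∑ᶠ j, f i j k := by
  have h1 : ∀ i, ∑ᶠ j, ∑ᶠ k, f i j k = ∑ᶠ k, ∑ᶠ j, f i j k := fun i =>
    finsum_comm_of_bound (N := N) fun j k hjk => h i j k (.inr hjk)
  rw [finsum_congr h1]
  refine finsum_comm_of_bound (N := N) fun i k hik => ?_
  exact finsum_eq_zero_of_forall_eq_zero fun j => h i j k (by tauto)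

theorem finsum_finsum_eq_sum_antidiagonal {M : Type*} [AddCommMonoid M] {f : ℕ → ℕ → M} {N : ℕ}
    (h : ∀ i j, N ≤ i + j → f i j = 0) :
    ∑ᶠ i, ∑ᶠ j, f i j =
      ∑ n ∈ Finset.range N, ∑ p ∈ antidiagonal n, f p.1 p.2 := by
  rw [finsum_eq_sum_range (N := N)]
  · rw [Finset.sum_congr rfl fun i _ => finsum_eq_sum_range (N := N) fun j hj => h i j (by lia)]
    rw [← Finset.sum_product', Finset.sum_sigma']
    symm
    refine Finset.sum_of_injOn (fun x => x.2) ?_ ?_ ?_ ?_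
    · rintro ⟨n, p⟩ hx ⟨m, q⟩ hy hxy
      simp only [Finset.coe_sigma, Set.mem_sigma_iff, Finset.mem_coe, mem_antidiagonal]
        at hx hy hxy
      subst hxy
      have : n = m := by lia
      subst this
      rfl
    · rintro ⟨n, p⟩ hx
      simp only [Finset.coe_sigma, Set.mem_sigma_iff, Finset.mem_coe, mem_antidiagonal,
        Finset.mem_range, Finset.coe_product, Set.mem_prod] at hx ⊢
      lia
    · rintro ⟨i, j⟩ _ hx
      refine h i j ?_
      by_contra hlt
      exact hx ⟨⟨i + j, (i, j)⟩, by simpa using hlt, rfl⟩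
    · intros
      rfl
  · intro i hi
    exact finsum_eq_zero_of_forall_eq_zero fun j => h i j (by lia)

theorem finsum_finsum_eq_finsum_antidiagonal {M : Type*} [AddCommMonoid M] {f : ℕ → ℕ → M} {N : ℕ}
    (h : ∀ i j, N ≤ i + j → f i j = 0) :
    ∑ᶠ i, ∑ᶠ j, f i j = ∑ᶠ n, ∑ p ∈ antidiagonal n, f p.1 p.2 := by
  rw [finsum_finsum_eq_sum_antidiagonal h, finsum_eq_sum_range (N := N)]
  intro n hn
  refine Finset.sum_eq_zero fun p hp => h _ _ ?_
  rw [mem_antidiagonal] at hp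
  lia

theorem Submodule.finsum_mem' {R M ι : Type*} [Semiring R] [AddCommMonoid M] [Module R M]
    (S : Submodule R M) {f : ι → M} (h : ∀ i, f i ∈ S) : ∑ᶠ i, f i ∈ S :=
  finsum_induction (· ∈ S) S.zero_mem (fun _ _ => S.add_mem) h

/-! ### Identities for generalized binomial coefficients. -/

theorem cast_choose_int (m : ℤ) (i : ℕ) : ((Ring.choose m i : ℤ) : ℂ) = Ring.choose (m : ℂ) i :=
  Ring.map_choose (Int.castRingHom ℂ) m i

theorem choose_succ_succ_add (α : ℂ) (k : ℕ) :
    Ring.choose (α + 1) (k + 1) = Ring.choose α k + Ring.choose α (k + 1) :=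
  Ring.choose_succ_succ α k

theorem succ_mul_choose_succ (α : ℂ) (i : ℕ) :
    ((i : ℂ) + 1) * Ring.choose α (i + 1) = α * Ring.choose (α - 1) i := by
  have h := Ring.choose_add_smul_choose (α - 1) i 1
  simpa using h

theorem succ_mul_choose_succ' (α : ℂ) (i : ℕ) :
    ((i : ℂ) + 1) * Ring.choose α (i + 1) = (α - i) * Ring.choose α i := by
  have h := Ring.choose_add_smul_choose (α - i) 1 i
  rw [sub_add_cancel, add_comm 1 i, Nat.choose_symm_of_eq_add (n := i + 1) (a := i) (b := 1) rfl,
    Nat.choose_one_right, Ring.choose_one_right, nsmul_eq_mul] at h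
  push_cast at h
  rw [h, mul_comm]

open PowerSeries in
-- Compare coefficients of `z^t` after applying `z^i (d/dz)^i / i!` to `(1+z)^α` and multiplying by
-- `(1+z)^β`.
theorem sum_antidiagonal_choose_mul_choose (α β : ℂ) (i t : ℕ) :
    ∑ p ∈ antidiagonal t, Ring.choose α p.1 * (p.1.choose i : ℂ) * Ring.choose β p.2 =
      Ring.choose α i * (if i ≤ t then Ring.choose (α + β - i) (t - i) else 0) := by
  have h : PowerSeries.mk (fun p => Ring.choose α p * (p.choose i : ℂ)) =
      C (Ring.choose α i) * (X ^ i * PowerSeries.binomialSeries ℂ (α - i)) := by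
    ext p
    rw [coeff_mk, coeff_C_mul, coeff_X_pow_mul']
    split_ifs with hp
    · obtain ⟨n, rfl⟩ := Nat.exists_eq_add_of_le' hp
      have h := Ring.choose_add_smul_choose (α - i) n i
      rw [sub_add_cancel, nsmul_eq_mul] at h
      rw [Nat.add_sub_cancel, PowerSeries.binomialSeries_coeff, smul_eq_mul, mul_one, mul_comm, h]
    · rw [Nat.choose_eq_zero_of_lt (by lia)]
      simp
  have h2 := congrArg (fun F => coeff t (F * PowerSeries.binomialSeries ℂ β)) h
  simp only [mul_assoc, ← PowerSeries.binomialSeries_add] at h2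
  rw [coeff_C_mul, coeff_X_pow_mul', coeff_mul] at h2
  simp only [coeff_mk, PowerSeries.binomialSeries_coeff, smul_eq_mul, mul_one] at h2
  rw [show α + β - i = α - i + β by ring]
  exact h2

/-- Both sides are the coefficient of `z₀^s z₂^{m+t-s}` in `(1+z₁)^α z₁^m (1+z₂)^β` at `z₁ = z₂ +
z₀`. On the left `(1+z₁)^α` is expanded in powers of `z₁` first; on the right `(1+z₂+z₀)^α` is
expanded in powers of `z₀` with coefficients in powers of `1+z₂`. -/
theorem sum_antidiagonal_choose_shift (α β m : ℂ) (s t : ℕ) :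
    ∑ p ∈ antidiagonal t, Ring.choose α p.1 * Ring.choose β p.2 * Ring.choose (m + p.1) s =
      ∑ q ∈ antidiagonal s, Ring.choose α q.1 * Ring.choose m q.2 *
        (if q.1 ≤ t then Ring.choose (α + β - q.1) (t - q.1) else 0) := by
  have h : ∀ p : ℕ, Ring.choose (m + p) s =
      ∑ q ∈ antidiagonal s, (p.choose q.1 : ℂ) * Ring.choose m q.2 := by
    intro p
    rw [add_comm, Ring.add_choose_eq s (Commute.all _ _)]
    simp only [Ring.choose_natCast]
  simp only [h, Finset.mul_sum]
  rw [Finset.sum_comm]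
  refine Finset.sum_congr rfl fun q _ => ?_
  rw [mul_assoc, mul_left_comm, ← sum_antidiagonal_choose_mul_choose, Finset.mul_sum]
  refine Finset.sum_congr rfl fun p _ => ?_
  ring

theorem neg_one_pow_mul_choose (β : ℂ) (k : ℕ) :
    (-1 : ℂ) ^ k * Ring.choose β k = Ring.choose (k - 1 - β) k := by
  have h := Ring.choose_neg (-β) k
  rw [neg_neg, Int.negOnePow_def] at h
  rw [h, show (k - 1 - β : ℂ) = -β + k - 1 by ring]
  rw [Units.smul_def]
  simp [← mul_assoc, ← mul_pow]

/-- The coefficient of `z^s` in `(1+z)^β (1 - z/(1+z))^α = (1+z)^{β-α}`. The proof reduces it to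
Vandermonde by reflecting the upper index. -/
theorem sum_antidiagonal_neg_one_pow_choose (α β : ℂ) (s : ℕ) :
    ∑ p ∈ antidiagonal s, (-1 : ℂ) ^ p.1 * Ring.choose α p.1 * Ring.choose (β - p.1) p.2 =
      Ring.choose (β - α) s := by
  have h1 : (-1 : ℂ) ^ s * Ring.choose (β - α) s = Ring.choose (α + (s - 1 - β)) s := by
    rw [neg_one_pow_mul_choose]
    congr 1
    ring
  rw [Ring.add_choose_eq s (Commute.all _ _)] at h1
  have h2 : (-1 : ℂ) ^ s * (-1 : ℂ) ^ s = 1 := by rw [← mul_pow]; simp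
  have h5 : Ring.choose (β - α) s = (-1 : ℂ) ^ s * ((-1 : ℂ) ^ s * Ring.choose (β - α) s) := by
    rw [← mul_assoc, h2, one_mul]
  rw [h5, h1, Finset.mul_sum]
  refine Finset.sum_congr rfl fun p hp => ?_
  rw [mem_antidiagonal] at hp
  have h3 : Ring.choose ((s : ℂ) - 1 - β) p.2 = (-1) ^ p.2 * Ring.choose (β - p.1) p.2 := by
    rw [neg_one_pow_mul_choose, ← hp]
    congr 1
    push_cast
    ring
  have h4 : (-1 : ℂ) ^ s * (-1) ^ p.2 = (-1) ^ p.1 := by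
    rw [← hp, pow_add, mul_assoc, ← mul_pow]
    simp
  rw [h3, ← h4]
  ring

/-- The substitution `z₁ = z₂ + z₀` for the right-hand side of the Jacobi identity: `e` depends only
on `p + q`, so the sum can be grouped by total degree. -/
theorem finsum_choose_shift {V : Type*} [AddCommGroup V] [Module ℂ V] (α β m : ℂ) (s : ℕ)
    (e : ℕ → V) (K : ℕ) (he : ∀ t, K ≤ t → e t = 0) :
    ∑ᶠ p : ℕ, ∑ᶠ q : ℕ, (Ring.choose α p * Ring.choose β q * Ring.choose (m + p) s) • e (p + q) =
      ∑ q ∈ antidiagonal s, (Ring.choose α q.1 * Ring.choose m q.2) •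
        ∑ᶠ t : ℕ, Ring.choose (α + β - q.1) t • e (q.1 + t) := by
  rw [finsum_finsum_eq_sum_antidiagonal (N := K) fun i j hij => by rw [he _ hij, smul_zero]]
  have h1 : ∀ n, ∑ p ∈ antidiagonal n, (Ring.choose α p.1 * Ring.choose β p.2 *
      Ring.choose (m + p.1) s) • e (p.1 + p.2) = ∑ q ∈ antidiagonal s,
        (Ring.choose α q.1 * Ring.choose m q.2) •
        (if q.1 ≤ n then Ring.choose (α + β - q.1) (n - q.1) else 0) • e n := by
    intro n
    simp only [smul_smul]
    rw [← Finset.sum_smul, ← sum_antidiagonal_choose_shift, Finset.sum_smul]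
    refine Finset.sum_congr rfl fun p hp => ?_
    rw [mem_antidiagonal.1 hp]
  simp only [h1]
  rw [Finset.sum_comm]
  refine Finset.sum_congr rfl fun q _ => ?_
  rw [← Finset.smul_sum]
  congr 1
  rw [finsum_eq_sum_range (N := K) fun i hi => by rw [he _ (by lia), smul_zero]]
  by_cases hK : q.1 ≤ K
  · obtain ⟨M, rfl⟩ := Nat.exists_eq_add_of_le hK
    rw [Finset.sum_range_add]
    rw [Finset.sum_eq_zero (s := Finset.range q.1), zero_add]
    · rw [add_comm q.1 M, Finset.sum_range_add]
      rw [Finset.sum_eq_zero (s := Finset.range q.1), add_zero]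
      · refine Finset.sum_congr rfl fun x _ => ?_
        simp
      · intro x _
        rw [he _ (by lia), smul_zero]
    · intro x hx
      rw [if_neg (by simpa using hx), zero_smul]
  · rw [Finset.sum_eq_zero, Finset.sum_eq_zero]
    · intro x hx
      rw [he _ (by lia), smul_zero]
    · intro x hx
      rw [Finset.mem_range] at hx
      rw [if_neg (by lia), zero_smul]

/-! ### The Jacobi identity for residues. -/

namespace VertexOperatorAlgebra

variable {V : Type*} [AddCommGroup V] [Module ℂ V] (A : VertexOperatorAlgebra V)

theorem exists_mode_eq_zero_of_lt (a : ℕ → V) (b : V) (S : ℕ) :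
    ∃ K : ℤ, ∀ s < S, ∀ x, K ≤ x → A.mode (a s) x b = 0 := by
  induction S with
  | zero => exact ⟨0, by simp⟩
  | succ S ih =>
    obtain ⟨K, hK⟩ := ih
    obtain ⟨K', hK'⟩ := A.mode_eventually_zero (a S) b
    refine ⟨max K K', fun s hs x hx => ?_⟩
    rcases Nat.lt_succ_iff_lt_or_eq.1 hs with h | rfl
    · exact hK s h x (by lia)
    · exact hK' x (by lia)

/-- Truncation uniform in `n ≥ n₀`: only finitely many of these `b_n c` are nonzero, and each has
its own bound for the modes of `a`. -/
theorem exists_mode_mode_eq_zero (a b c : V) (n₀ : ℤ) :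
    ∃ K : ℤ, (∀ n, K ≤ n → A.mode b n c = 0) ∧
      ∀ m, K ≤ m → ∀ n, n₀ ≤ n → A.mode a m (A.mode b n c) = 0 := by
  obtain ⟨N, hN⟩ := A.mode_eventually_zero b c
  have h : ∀ S : ℕ, ∃ K : ℤ, ∀ s < S, ∀ m, K ≤ m → A.mode a m (A.mode b (n₀ + s) c) = 0 := by
    intro S
    induction S with
    | zero => exact ⟨0, by simp⟩
    | succ S ih =>
      obtain ⟨K, hK⟩ := ih
      obtain ⟨K', hK'⟩ := A.mode_eventually_zero a (A.mode b (n₀ + S) c)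
      refine ⟨max K K', fun s hs x hx => ?_⟩
      rcases Nat.lt_succ_iff_lt_or_eq.1 hs with h | rfl
      · exact hK s h x (by lia)
      · exact hK' x (by lia)
  obtain ⟨K, hK⟩ := h (N - n₀).toNat
  refine ⟨max K N, fun n hn => hN n (by lia), fun m hm n hn => ?_⟩
  by_cases hnN : N ≤ n
  · rw [hN n hnN, map_zero]
  · have := hK (n - n₀).toNat (by lia) m (by lia)
    rwa [show n₀ + ((n - n₀).toNat : ℤ) = n by lia] at this

theorem residue_eventually_zero (α : ℂ) (u v : V) :
    ∃ N : ℤ, ∀ k, N ≤ k → A.residue α k u v = 0 := by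
  obtain ⟨N, hN⟩ := A.mode_eventually_zero u v
  refine ⟨N, fun k hk => ?_⟩
  rw [residue_apply]
  refine finsum_eq_zero_of_forall_eq_zero fun i => ?_
  rw [hN _ (by lia), smul_zero]

theorem residue_residue (α β : ℂ) (k l : ℤ) (a b c : V) :
    A.residue α k a (A.residue β l b c) = ∑ᶠ p : ℕ, ∑ᶠ q : ℕ,
      (Ring.choose α p * Ring.choose β q) • A.mode a (k + p) (A.mode b (l + q) c) := by
  rw [residue_apply]
  refine finsum_congr fun p => ?_
  rw [residue_apply, map_finsum _ (A.residue_finite β l b c),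
    smul_finsum]
  refine finsum_congr fun q => ?_
  rw [map_smul, smul_smul]

theorem jacobi_complex (u v w : V) (l m n : ℤ) :
    (∑ᶠ i : ℕ, ((-1 : ℂ) ^ i * Ring.choose (l : ℂ) i) •
        A.mode u (m + l - i) (A.mode v (n + i) w)) -
      ((Int.negOnePow l : ℤ) : ℂ) • (∑ᶠ i : ℕ, ((-1 : ℂ) ^ i * Ring.choose (l : ℂ) i) •
        A.mode v (n + l - i) (A.mode u (m + i) w)) =
    ∑ᶠ i : ℕ, Ring.choose (m : ℂ) i • A.mode (A.mode u (l + i) v) (m + n - i) w := by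
  have h := A.jacobi u v w l m n
  simp only [← Int.cast_smul_eq_zsmul ℂ, Int.cast_mul, Int.cast_pow, Int.cast_neg, Int.cast_one,
    cast_choose_int] at h
  exact h

theorem exists_bound_mode_mode (l m n : ℤ) (a b c : V) :
    ∃ N : ℕ, (∀ p q i : ℕ, N ≤ p ∨ N ≤ q ∨ N ≤ i →
      A.mode a (m + p + l - i) (A.mode b (n + q + i) c) = 0) := by
  obtain ⟨K, hK, hK'⟩ := A.exists_mode_mode_eq_zero a b c n
  refine ⟨(K - n).toNat + (K - m - l).toNat, fun p q i h => ?_⟩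
  -- Large `i` lowers the index of the outer mode, but it also kills the inner one. If the inner
  -- mode may survive, then `q` and `i` are below `K - n`, so `p` is the large index and outweighs
  -- `i`.
  by_cases hq : K ≤ n + q + i
  · rw [hK _ hq, map_zero]
  · exact hK' _ (by lia) _ (by lia)

theorem finsum_residue_residue (α β : ℂ) (l m n : ℤ) (ε : ℕ → ℂ) (a b c : V) :
    ∑ᶠ p : ℕ, ∑ᶠ q : ℕ, (Ring.choose α p * Ring.choose β q) • ∑ᶠ i : ℕ, ε i •
        A.mode a (m + p + l - i) (A.mode b (n + q + i) c) =
      ∑ᶠ i : ℕ, ε i • A.residue α (m + l - i) a (A.residue β (n + i) b c) := by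
  obtain ⟨N, hN⟩ := A.exists_bound_mode_mode l m n a b c
  simp only [smul_finsum, residue_residue]
  rw [finsum_rotate_of_bound (N := N)]
  · refine finsum_congr fun i => finsum_congr fun p => finsum_congr fun q => ?_
    rw [smul_comm, show m + p + l - i = m + l - i + p by ring,
      show n + q + i = n + i + q by ring]
  · intro p q i h
    rw [hN p q i h, smul_zero, smul_zero]

theorem finsum_residue_residue' (α β : ℂ) (l m n : ℤ) (ε : ℕ → ℂ) (a b c : V) :
    ∑ᶠ p : ℕ, ∑ᶠ q : ℕ, (Ring.choose α p * Ring.choose β q) • ∑ᶠ i : ℕ, ε i •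
        A.mode b (n + q + l - i) (A.mode a (m + p + i) c) =
      ∑ᶠ i : ℕ, ε i • A.residue β (n + l - i) b (A.residue α (m + i) a c) := by
  obtain ⟨N, hN⟩ := A.exists_bound_mode_mode l n m b a c
  rw [← finsum_residue_residue]
  rw [finsum_comm_of_bound (N := N)]
  · refine finsum_congr fun q => finsum_congr fun p => ?_
    rw [mul_comm]
  · intro p q h
    rw [finsum_eq_zero_of_forall_eq_zero, smul_zero]
    intro i
    rw [hN q p i (by tauto), smul_zero]

theorem finsum_choose_mul_choose_smul_sub {f g : ℕ → ℕ → V} {N : ℕ} (α β : ℂ)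
    (hf : ∀ p q, N ≤ p ∨ N ≤ q → f p q = 0) (hg : ∀ p q, N ≤ p ∨ N ≤ q → g p q = 0) (z : ℂ) :
    ∑ᶠ p : ℕ, ∑ᶠ q : ℕ, (Ring.choose α p * Ring.choose β q) • (f p q - z • g p q) =
      ∑ᶠ p : ℕ, ∑ᶠ q : ℕ, (Ring.choose α p * Ring.choose β q) • f p q -
      z • ∑ᶠ p : ℕ, ∑ᶠ q : ℕ, (Ring.choose α p * Ring.choose β q) • g p q := by
  have key : ∀ h : ℕ → ℕ → V, (∀ p q, N ≤ p ∨ N ≤ q → h p q = 0) →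
      ∑ᶠ p : ℕ, ∑ᶠ q : ℕ, (Ring.choose α p * Ring.choose β q) • h p q =
      ∑ p ∈ Finset.range N, ∑ q ∈ Finset.range N, (Ring.choose α p * Ring.choose β q) • h p q := by
    intro h hh
    rw [finsum_eq_sum_range (N := N)]
    · refine Finset.sum_congr rfl fun p _ => finsum_eq_sum_range fun q hq => ?_
      rw [hh p q (.inr hq), smul_zero]
    · intro p hp
      refine finsum_eq_zero_of_forall_eq_zero fun q => ?_
      rw [hh p q (.inl hp), smul_zero]
  rw [key f hf, key g hg, key (fun p q => f p q - z • g p q)]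
  · simp only [smul_sub, Finset.sum_sub_distrib, Finset.smul_sum]
    congr 1
    refine Finset.sum_congr rfl fun p _ => Finset.sum_congr rfl fun q _ => ?_
    rw [smul_comm]
  · intro p q h
    rw [hf p q h, hg p q h, smul_zero, sub_zero]

/-- The coefficient form of the Jacobi identity, paired with
`(1+z₁)^α z₁^m (1+z₂)^β z₂^n (z₁-z₂)^l`. -/
theorem residue_jacobi (α β : ℂ) (l m n : ℤ) (a b c : V) :
    (∑ᶠ i : ℕ, ((-1 : ℂ) ^ i * Ring.choose (l : ℂ) i) •
        A.residue α (m + l - i) a (A.residue β (n + i) b c)) -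
      ((Int.negOnePow l : ℤ) : ℂ) • (∑ᶠ i : ℕ, ((-1 : ℂ) ^ i * Ring.choose (l : ℂ) i) •
        A.residue β (n + l - i) b (A.residue α (m + i) a c)) =
    ∑ᶠ s : ℕ, ∑ q ∈ antidiagonal s, (Ring.choose α q.1 * Ring.choose (m : ℂ) q.2) •
      A.residue (α + β - q.1) (m + n - q.2) (A.mode a (l + s) b) c := by
  obtain ⟨N, hN⟩ := A.exists_bound_mode_mode l m n a b c
  obtain ⟨N', hN'⟩ := A.exists_bound_mode_mode l n m b a c
  rw [← A.finsum_residue_residue, ← A.finsum_residue_residue',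
    ← finsum_choose_mul_choose_smul_sub (N := max N N')]
  rotate_left
  · intro p q h
    refine finsum_eq_zero_of_forall_eq_zero fun i => ?_
    rw [hN p q i (by lia), smul_zero]
  · intro p q h
    refine finsum_eq_zero_of_forall_eq_zero fun i => ?_
    rw [hN' q p i (by lia), smul_zero]
  obtain ⟨S, hS⟩ := A.mode_eventually_zero a b
  obtain ⟨K, hK⟩ := A.exists_mode_eq_zero_of_lt (fun s => A.mode a (l + s) b) c (S - l).toNat
  have hz : ∀ s : ℕ, ∀ x, K ≤ x ∨ S - l ≤ s → A.mode (A.mode a (l + s) b) x c = 0 := by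
    intro s x h
    by_cases hs : S - l ≤ s
    · rw [hS _ (by lia)]
      simp [mode, vertexMode]
    · exact hK s (by lia) x (by lia)
  have h1 : ∀ p q : ℕ, _ := fun p q : ℕ => A.jacobi_complex a b c l (m + p) (n + q)
  simp only [h1]
  simp only [smul_finsum]
  -- For fixed `s` the modes of `a_{l+s} b` depend on `p` and `q` only through `p + q`, so `s` is
  -- moved outermost.
  rw [finsum_rotate_of_bound (N := (K - m - n).toNat + (S - l).toNat)]
  · refine finsum_congr fun s => ?_
    have h2 := finsum_choose_shift α β m s
      (fun t => A.mode (A.mode a (l + s) b) (m + n - s + t) c) ((K - m - n).toNat + s)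
      fun t ht => hz s _ (by lia)
    convert h2 using 1
    · refine finsum_congr fun p => finsum_congr fun q => ?_
      rw [smul_smul]
      push_cast
      rw [show m + p + (n + q) - (s : ℤ) = m + n - s + (p + q) by ring]
    · refine Finset.sum_congr rfl fun q hq => ?_
      rw [mem_antidiagonal] at hq
      rw [residue_apply]
      congr 1
      refine finsum_congr fun t => ?_
      rw [show m + n - (q.2 : ℤ) + t = m + n - s + ((q.1 + t : ℕ) : ℤ) by lia]
  · intro p q s h
    rw [hz s _ (by lia), smul_zero, smul_zero]

end VertexOperatorAlgebra

/-! ### Virasoro commutators, weights and eigenspaces. -/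

namespace VertexOperatorAlgebra

variable {V : Type*} [AddCommGroup V] [Module ℂ V] (A : VertexOperatorAlgebra V)

theorem mode_commutator (u v w : V) (m n : ℤ) :
    A.mode u m (A.mode v n w) - A.mode v n (A.mode u m w) =
      ∑ᶠ i : ℕ, Ring.choose (m : ℂ) i • A.mode (A.mode u i v) (m + n - i) w := by
  have h := A.jacobi_complex u v w 0 m n
  have h0 : ∀ i : ℕ, i ≠ 0 → Ring.choose ((0 : ℤ) : ℂ) i = 0 := by
    intro i hi
    rw [Int.cast_zero, Ring.choose_zero_pos _ (Nat.pos_of_ne_zero hi)]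
  rw [finsum_eq_single _ 0 (fun i hi => by rw [h0 i hi, mul_zero, zero_smul]),
    finsum_eq_single _ 0 (fun i hi => by rw [h0 i hi, mul_zero, zero_smul])] at h
  simpa using h

theorem L_zero_apply {n : ℤ} {v : V} (hv : v ∈ A.wt n) : A.L 0 v = (n : ℂ) • v :=
  A.L_zero n v hv

theorem L_zero_mode (a w : V) (n : ℤ) :
    A.L 0 (A.mode a n w) = A.mode a n (A.L 0 w) - ((n : ℂ) + 1) • A.mode a n w +
      A.mode (A.L 0 a) n w := by
  have h := A.mode_commutator A.omega a w 1 n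
  rw [finsum_eq_sum_range (N := 2)] at h
  · simp only [Finset.sum_range_succ, Finset.sum_range_zero, zero_add, Ring.choose_zero_right,
      Int.cast_one, Ring.choose_one_right, one_smul, Nat.cast_zero, Nat.cast_one, sub_zero] at h
    have h1 := congrArg (fun f => f w) (A.L_neg_one a (1 + n))
    simp only [LinearMap.smul_apply] at h1
    rw [mode, mode, mode, mode, h1, sub_eq_iff_eq_add] at h
    change A.L 0 (A.mode a n w) = _ at h
    rw [h]
    rw [add_sub_cancel_left]
    change _ + A.mode (A.L 0 a) n w + A.mode a n (A.L 0 w) = _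
    push_cast
    module
  · intro i hi
    have : Ring.choose ((1 : ℤ) : ℂ) i = 0 := by
      have := Ring.choose_natCast (R := ℂ) 1 i
      rw [Nat.choose_eq_zero_of_lt (by lia)] at this
      exact_mod_cast this
    rw [this, zero_smul]

theorem L_one_mode (a w : V) (n : ℤ) {p : ℤ} (ha : a ∈ A.wt p) :
    A.L 1 (A.mode a n w) = A.mode a n (A.L 1 w) + (2 * p - n - 2 : ℂ) • A.mode a (n + 1) w +
      A.mode (A.L 1 a) n w := by
  have h := A.mode_commutator A.omega a w 2 n
  rw [finsum_eq_sum_range (N := 3)] at h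
  · have h2 : Ring.choose (2 : ℂ) 2 = 1 := by
      have := Ring.choose_natCast (R := ℂ) 2 2
      rw [Nat.choose_self] at this
      exact_mod_cast this
    have h0 : A.mode A.omega 1 a = (p : ℂ) • a := A.L_zero p a ha
    simp only [Finset.sum_range_succ, Finset.sum_range_zero, zero_add, Ring.choose_zero_right,
      Int.cast_ofNat, Ring.choose_one_right, one_smul, Nat.cast_zero, Nat.cast_one, sub_zero,
      Nat.cast_ofNat, h2, h0, mode_smul, LinearMap.smul_apply] at h
    have h1 := congrArg (fun f => f w) (A.L_neg_one a (2 + n))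
    simp only [LinearMap.smul_apply] at h1
    rw [show vertexMode A.Y (vertexMode A.Y A.omega 0 a) (2 + n) w = _ from h1,
      sub_eq_iff_eq_add] at h
    change A.L 1 (A.mode a n w) = _ + A.mode (A.L 1 a) _ w + A.mode a n (A.L 1 w) at h
    rw [h, show 2 + n - 2 = n by ring, show 2 + n - 1 = n + 1 by ring]
    push_cast
    module
  · intro i hi
    have : Ring.choose ((2 : ℤ) : ℂ) i = 0 := by
      have := Ring.choose_natCast (R := ℂ) 2 i
      rw [Nat.choose_eq_zero_of_lt (by lia)] at this
      exact_mod_cast this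
    rw [this, zero_smul]

theorem mode_mem_wt {p q r : ℤ} {a b : V} (ha : a ∈ A.wt p) (hb : b ∈ A.wt q) (n : ℤ)
    (hr : r = p + q - n - 1) : A.mode a n b ∈ A.wt r := by
  apply A.mem_wt_of_L_zero
  rw [L_zero_mode, A.L_zero_apply hb, A.L_zero_apply ha, mode_smul, map_smul,
    LinearMap.smul_apply, hr]
  push_cast
  module

theorem L_neg_one_mode (u : V) (n : ℤ) :
    A.mode (A.L (-1) u) n = (-(n : ℂ)) • A.mode u (n - 1) := A.L_neg_one u n

theorem L_neg_one_mem {n : ℤ} {v : V} (hv : v ∈ A.wt n) : A.L (-1) v ∈ A.wt (n + 1) :=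
  A.mode_mem_wt A.omega_mem hv _ (by ring)

section Automorphism

variable {A} (g : A.Aut)

theorem aut_mode (u v : V) (n : ℤ) : g.1 (A.mode u n v) = A.mode (g.1 u) n (g.1 v) :=
  g.2.1 u v n

theorem aut_mem_wt {n : ℤ} {v : V} (hv : v ∈ A.wt n) : g.1 v ∈ A.wt n := by
  apply A.mem_wt_of_L_zero
  have h := aut_mode g A.omega v 1
  rw [g.2.2.2] at h
  rw [← map_smul, ← A.L_zero_apply hv]
  exact h.symm

theorem aut_pow_mem_wt {n : ℤ} {v : V} (hv : v ∈ A.wt n) (k : ℕ) :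
    (g.1 ^ k : V ≃ₗ[ℂ] V) v ∈ A.wt n := by
  induction k with
  | zero => simpa using hv
  | succ k ih =>
    rw [pow_succ', LinearEquiv.mul_apply]
    exact aut_mem_wt g ih

theorem mem_eigen_iff {r : ℕ} {v : V} : v ∈ A.eigen g r ↔
    g.1 v = Complex.exp (2 * Real.pi * Complex.I / orderOf g) ^ r • v := by
  rw [eigen, Module.End.mem_eigenspace_iff, ← Complex.exp_nat_mul,
    show (r : ℂ) * (2 * Real.pi * Complex.I / orderOf g) =
      2 * Real.pi * Complex.I * r / orderOf g by ring]
  rfl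

/-- The index `r + s` is left unreduced; `eigen_mod` brings it back below the order of `g` when
needed. -/
theorem mode_mem_eigen {r s : ℕ} {a b : V} (ha : a ∈ A.eigen g r) (hb : b ∈ A.eigen g s) (n : ℤ) :
    A.mode a n b ∈ A.eigen g (r + s) := by
  rw [mem_eigen_iff] at *
  rw [aut_mode, ha, hb, mode_smul, map_smul, LinearMap.smul_apply, smul_smul, pow_add, mul_comm]

theorem omega_mem_eigen : A.omega ∈ A.eigen g 0 := by
  rw [mem_eigen_iff, pow_zero, one_smul]
  exact g.2.2.2

theorem vacuum_mem_eigen : A.vacuum ∈ A.eigen g 0 := by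
  rw [mem_eigen_iff, pow_zero, one_smul]
  exact g.2.2.1

theorem L_mem_eigen {r : ℕ} {a : V} (ha : a ∈ A.eigen g r) (n : ℤ) : A.L n a ∈ A.eigen g r := by
  have := mode_mem_eigen g (omega_mem_eigen g) ha (n + 1)
  rwa [zero_add] at this

theorem exp_isPrimitiveRoot_order (hg : IsOfFinOrder g) :
    IsPrimitiveRoot (Complex.exp (2 * Real.pi * Complex.I / orderOf g)) (orderOf g) :=
  Complex.isPrimitiveRoot_exp _ hg.orderOf_pos.ne'

theorem eigen_mod (hg : IsOfFinOrder g) (r : ℕ) : A.eigen g (r % orderOf g) = A.eigen g r := by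
  ext v
  rw [mem_eigen_iff, mem_eigen_iff]
  conv_rhs => rw [← Nat.div_add_mod r (orderOf g), pow_add, pow_mul,
    (exp_isPrimitiveRoot_order g hg).pow_eq_one, one_pow, one_mul]

theorem eigen_orderOf (hg : IsOfFinOrder g) : A.eigen g (orderOf g) = A.eigen g 0 := by
  rw [← eigen_mod g hg, Nat.mod_self]

/-- Finite Fourier analysis over the cyclic group generated by `g`, which preserves weights: every
homogeneous vector is a sum of homogeneous eigenvectors. -/
theorem eq_top_of_homogeneous_mem (hg : IsOfFinOrder g) (S : Submodule ℂ V)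
    (h : ∀ (n : ℤ) (r : ℕ) (u : V), r < orderOf g → u ∈ A.wt n → u ∈ A.eigen g r → u ∈ S) :
    S = ⊤ := by
  rw [eq_top_iff, ← A.isInternal.submodule_iSup_eq_top]
  refine iSup_le fun n v hv => ?_
  have hζ := exp_isPrimitiveRoot_order g hg
  have hT : (orderOf g : ℂ) ≠ 0 := by exact_mod_cast hg.orderOf_pos.ne'
  set ζ := Complex.exp (2 * Real.pi * Complex.I / orderOf g) with hζdef
  have hζ0 : ζ ≠ 0 := Complex.exp_ne_zero _
  have hgT : g.1 ^ orderOf g = 1 := by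
    exact congrArg Subtype.val (pow_orderOf_eq_one g)
  -- Summed over `k`, `f r k` is `T` times the projection of `v` to `V^r`; summed over `r`, it
  -- vanishes unless `k = 0`.
  let f : ℕ → ℕ → V := fun r k => (ζ⁻¹) ^ (r * k) • (g.1 ^ k : V ≃ₗ[ℂ] V) v
  have hmem : ∀ r < orderOf g, ∑ k ∈ Finset.range (orderOf g), f r k ∈ S := by
    intro r hr
    refine h n r _ hr ?_ ?_
    · exact Submodule.sum_mem _ fun k _ => Submodule.smul_mem _ _ (aut_pow_mem_wt g hv k)
    · rw [mem_eigen_iff, map_sum]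
      have h1 : ∀ k, g.1 (f r k) = ζ ^ r • f r (k + 1) := by
        intro k
        simp only [f]
        rw [map_smul, smul_smul, ← LinearEquiv.mul_apply, ← pow_succ']
        congr 1
        rw [mul_add, mul_one, pow_add, mul_left_comm, ← mul_pow, mul_inv_cancel₀ hζ0, one_pow,
          mul_one]
      have h2 : f r (orderOf g) = f r 0 := by
        simp only [f]
        rw [hgT, pow_zero, mul_comm, pow_mul, inv_pow, hζ.pow_eq_one]
        simp
      simp only [h1, ← Finset.smul_sum]
      congr 1
      have h3 := Finset.sum_range_succ (f r) (orderOf g)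
      rw [Finset.sum_range_succ', h2] at h3
      exact add_right_cancel h3
  have hsum : ∑ r ∈ Finset.range (orderOf g), ∑ k ∈ Finset.range (orderOf g), f r k =
      (orderOf g : ℂ) • v := by
    rw [Finset.sum_comm, Finset.sum_eq_single 0]
    · simp [f, ← Nat.cast_smul_eq_nsmul ℂ]
    · intro k hk hk0
      simp only [f, ← Finset.sum_smul]
      have hne : (ζ⁻¹) ^ k ≠ 1 :=
        hζ.inv.pow_ne_one_of_pos_of_lt hk0 (Finset.mem_range.1 hk)
      have h4 : ∀ r, (ζ⁻¹) ^ (r * k) = ((ζ⁻¹) ^ k) ^ r := fun r => by rw [mul_comm, pow_mul]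
      simp only [h4]
      rw [geom_sum_eq hne, ← pow_mul, mul_comm k, pow_mul, hζ.inv.pow_eq_one]
      simp
    · intro h0
      exact absurd (Finset.mem_range.2 hg.orderOf_pos) h0
  have hv' : v = (orderOf g : ℂ)⁻¹ •
      ∑ r ∈ Finset.range (orderOf g), ∑ k ∈ Finset.range (orderOf g), f r k := by
    rw [hsum, smul_smul, inv_mul_cancel₀ hT, one_smul]
  rw [hv']
  exact Submodule.smul_mem _ _ (Submodule.sum_mem _ fun r hr => hmem r (Finset.mem_range.1 hr))

end Automorphism

end VertexOperatorAlgebra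

/-! ### Elements of `O_g(V)` and the ideal property. -/

namespace VertexOperatorAlgebra

variable {V : Type*} [AddCommGroup V] [Module ℂ V] (A : VertexOperatorAlgebra V)

theorem residue_eq_sum_range {k : ℤ} {u v : V} {N : ℕ} (h : ∀ n, k + N ≤ n → A.mode u n v = 0)
    (α : ℂ) :
    A.residue α k u v = ∑ i ∈ Finset.range N, Ring.choose α i • A.mode u (k + i) v := by
  rw [residue_apply, finsum_eq_sum_range (N := N)]
  intro i hi
  rw [h _ (by lia), smul_zero]

theorem residue_mem (S : Submodule ℂ V) {u v : V} (h : ∀ n, A.mode u n v ∈ S) (α : ℂ) (k : ℤ) :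
    A.residue α k u v ∈ S := by
  rw [residue_apply]
  exact S.finsum_mem' fun i => S.smul_mem _ (h _)

/-- `(1+z)^{α+1} = (1+z)^α + z (1+z)^α`. -/
theorem residue_add_one (α : ℂ) (k : ℤ) (u v : V) :
    A.residue (α + 1) k u v = A.residue α k u v + A.residue α (k + 1) u v := by
  obtain ⟨M, hM⟩ := A.mode_eventually_zero u v
  have h1 : ∀ n, k + ((M - k).toNat + 1 : ℕ) ≤ n → A.mode u n v = 0 := fun n hn => hM n (by lia)
  have h2 : ∀ n, k + 1 + ((M - k).toNat : ℕ) ≤ n → A.mode u n v = 0 := fun n hn => hM n (by lia)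
  rw [A.residue_eq_sum_range h1, A.residue_eq_sum_range h1, A.residue_eq_sum_range h2,
    Finset.sum_range_succ', Finset.sum_range_succ' _ (M - k).toNat]
  have h3 : ∀ i : ℕ, k + ((i + 1 : ℕ) : ℤ) = k + 1 + i := fun i => by lia
  simp only [h3, choose_succ_succ_add, add_smul, Finset.sum_add_distrib, Ring.choose_zero_right]
  abel

/-- Integration by parts, since `Y(L(-1)u,z) = d/dz Y(u,z)` and the residue of a derivative is zero.
-/
theorem residue_L_neg_one (α : ℂ) (k : ℤ) (u v : V) :
    A.residue α k (A.L (-1) u) v =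
      -(α • A.residue (α - 1) k u v) - (k : ℂ) • A.residue α (k - 1) u v := by
  obtain ⟨M, hM⟩ := A.mode_eventually_zero u v
  have h1 : ∀ n, k + ((M - k).toNat + 1 : ℕ) ≤ n → A.mode (A.L (-1) u) n v = 0 := by
    intro n hn
    rw [L_neg_one_mode, LinearMap.smul_apply, hM _ (by lia), smul_zero]
  have h2 : ∀ n, k + ((M - k).toNat : ℕ) ≤ n → A.mode u n v = 0 := fun n hn => hM n (by lia)
  have h3 : ∀ n, k - 1 + ((M - k).toNat + 1 : ℕ) ≤ n → A.mode u n v = 0 :=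
    fun n hn => hM n (by lia)
  rw [A.residue_eq_sum_range h1, A.residue_eq_sum_range h2, A.residue_eq_sum_range h3]
  have h4 : ∀ i : ℕ, Ring.choose α i • A.mode (A.L (-1) u) (k + i) v =
      -(((i : ℂ) * Ring.choose α i) • A.mode u (k - 1 + i) v) -
        (k : ℂ) • (Ring.choose α i • A.mode u (k - 1 + i) v) := by
    intro i
    rw [L_neg_one_mode, LinearMap.smul_apply, show k + (i : ℤ) - 1 = k - 1 + i by ring]
    push_cast
    module
  simp only [h4, Finset.sum_sub_distrib, Finset.sum_neg_distrib, ← Finset.smul_sum]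
  congr 2
  rw [Finset.sum_range_succ']
  have h5 : ∀ i : ℕ, k - 1 + ((i + 1 : ℕ) : ℤ) = k + i := fun i => by lia
  simp only [h5]
  simp only [Nat.cast_add, Nat.cast_one, succ_mul_choose_succ, Nat.cast_zero, zero_mul,
    zero_smul, add_zero, mul_smul, Finset.smul_sum]

theorem residue_neg_one_vacuum (α : ℂ) (u : V) : A.residue α (-1) u A.vacuum = u := by
  have h : ∀ n : ℤ, -1 + (1 : ℕ) ≤ n → A.mode u n A.vacuum = 0 :=
    fun n hn => A.creation_nonneg u n (by lia)
  rw [A.residue_eq_sum_range h]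
  simp [A.creation]

theorem star_eq_residue {g : A.Aut} (hg : IsOfFinOrder g) {n : ℤ} {u : V} (hn : u ∈ A.wt n)
    (hu : u ∈ A.eigen g 0) (v : V) : A.star g u v = A.residue n (-1) u v :=
  A.star_apply_zero g hg hn hu v

section Automorphism

variable {A} {g : A.Aut}

theorem homogeneous_induction (hg : IsOfFinOrder g) {P : V → Prop}
    (add : ∀ u v, P u → P v → P (u + v)) (smul : ∀ (c : ℂ) u, P u → P (c • u))
    (h : ∀ (n : ℤ) (r : ℕ) (u : V), r < orderOf g → u ∈ A.wt n → u ∈ A.eigen g r → P u)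
    (v : V) : P v := by
  let S : Submodule ℂ V :=
    { carrier := {v | P v}
      add_mem' := fun {u v} => add u v
      zero_mem' := h 0 0 0 hg.orderOf_pos (Submodule.zero_mem _) (Submodule.zero_mem _)
      smul_mem' := fun c u => smul c u }
  have : S = ⊤ := eq_top_of_homogeneous_mem g hg S h
  exact (this ▸ Submodule.mem_top : v ∈ S)

/-- Induction on the pole order, applied to `L(-1)u`, whose weight is one higher. Integration by
parts leaves known elements and `k` times the residue with one more pole; `k` is negative, so it can
be divided out. -/
theorem residue_mem_Og_of_pole {p : ℤ} {r : ℕ} (hr : r < orderOf g) {u : V} (hp : u ∈ A.wt p)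
    (hu : u ∈ A.eigen g r) (v : V) (m : ℕ) :
    A.residue (p - 1 + (if r = 0 then 1 else 0) + r / orderOf g)
      (-1 - (if r = 0 then 1 else 0) - m) u v ∈ A.Og g := by
  induction m generalizing p u with
  | zero =>
    refine Submodule.subset_span ⟨p, r, u, v, hr, hp, hu, ?_⟩
    simp [circ]
  | succ m ih =>
    have h1 := ih (A.L_neg_one_mem hp) (L_mem_eigen g hu _)
    have h2 := ih hp hu
    have hne : ((-1 - (if r = 0 then 1 else 0) - m : ℤ) : ℂ) ≠ 0 := by
      have : (-1 - (if r = 0 then 1 else 0) - m : ℤ) ≠ 0 := by split_ifs <;> lia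
      exact_mod_cast this
    have hexp : ((p + 1 : ℤ) : ℂ) - 1 + (if r = 0 then 1 else 0) + r / orderOf g =
        p - 1 + (if r = 0 then 1 else 0) + r / orderOf g + 1 := by
      push_cast
      ring
    rw [hexp, residue_L_neg_one, add_sub_cancel_right, residue_add_one, sub_add_cancel] at h1
    rw [Submodule.sub_mem_iff_right _ ((A.Og g).neg_mem ((A.Og g).smul_mem _ h2)),
      Submodule.smul_mem_iff _ hne, Submodule.add_mem_iff_left _ h2] at h1
    rw [show (-1 - (if r = 0 then 1 else 0) - ((m + 1 : ℕ) : ℤ) : ℤ) =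
      -1 - (if r = 0 then 1 else 0) - m - 1 by push_cast; ring]
    exact h1

/-- `Res_z (1+z)^{wt u-1+δ_r+r/T+j} z^{-1-δ_r-m} Y(u,z)v ∈ O_g(V)` for `0 ≤ j ≤ m`. -/
theorem residue_mem_Og {p : ℤ} {r : ℕ} (hr : r < orderOf g) {u : V} (hp : u ∈ A.wt p)
    (hu : u ∈ A.eigen g r) (v : V) {α : ℂ} {k : ℤ} (j m : ℕ) (hjm : j ≤ m)
    (hα : α = p - 1 + (if r = 0 then 1 else 0) + r / orderOf g + j)
    (hk : k = -1 - (if r = 0 then 1 else 0) - m) :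
    A.residue α k u v ∈ A.Og g := by
  induction j generalizing α k m with
  | zero =>
    rw [hα, hk, Nat.cast_zero, add_zero]
    exact residue_mem_Og_of_pole hr hp hu v m
  | succ j ih =>
    obtain ⟨m, rfl⟩ := Nat.exists_eq_add_of_le' (show 1 ≤ m by lia)
    rw [hα, Nat.cast_succ, ← add_assoc, residue_add_one]
    refine Submodule.add_mem _ (ih (m + 1) (by lia) rfl hk) (ih m (by lia) rfl ?_)
    rw [hk]
    push_cast
    ring

theorem residue_mem_Og_zero (hg : IsOfFinOrder g) {p : ℤ} {u : V} (hp : u ∈ A.wt p)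
    (hu : u ∈ A.eigen g 0) (v : V) {α : ℂ} {k : ℤ} (j m : ℕ) (hjm : j ≤ m)
    (hα : α = p + j) (hk : k = -2 - m) : A.residue α k u v ∈ A.Og g := by
  refine residue_mem_Og hg.orderOf_pos hp hu v j m hjm ?_ ?_
  · rw [hα]
    simp
  · rw [hk]
    simp

theorem residue_mem_Og_pos {p : ℤ} {r : ℕ} (h0 : r ≠ 0) (hr : r < orderOf g) {u : V}
    (hp : u ∈ A.wt p)
    (hu : u ∈ A.eigen g r) (v : V) {α : ℂ} {k : ℤ} (j m : ℕ) (hjm : j ≤ m)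
    (hα : α = p - 1 + r / orderOf g + j) (hk : k = -1 - m) : A.residue α k u v ∈ A.Og g := by
  refine residue_mem_Og hr hp hu v j m hjm ?_ ?_
  · rw [hα]
    simp [h0]
  · rw [hk]
    simp [h0]

/-- Here `δ_r = 0`, so the pole is simple and `u ∘_g 𝟏 = u`. -/
theorem mem_Og_of_mem_eigen {p : ℤ} {r : ℕ} (h0 : r ≠ 0) (hr : r < orderOf g) {u : V}
    (hp : u ∈ A.wt p) (hu : u ∈ A.eigen g r) : u ∈ A.Og g := by
  have h := residue_mem_Og_pos h0 hr hp hu A.vacuum (k := -1) 0 0 le_rfl rfl (by simp)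
  rwa [residue_neg_one_vacuum] at h

theorem star_eq_zero_of_mod_ne (hg : IsOfFinOrder g) {r : ℕ} (h0 : r % orderOf g ≠ 0) {u : V}
    (hu : u ∈ A.eigen g r) (v : V) : A.star g u v = 0 :=
  A.star_apply_pos g (Nat.pos_of_ne_zero h0) (Nat.mod_lt _ hg.orderOf_pos)
    (by rwa [eigen_mod g hg]) v

theorem residue_mem_eigen {r s : ℕ} {a b : V} (ha : a ∈ A.eigen g r) (hb : b ∈ A.eigen g s)
    (α : ℂ) (k : ℤ) : A.residue α k a b ∈ A.eigen g (r + s) :=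
  A.residue_mem _ (mode_mem_eigen g ha hb) α k

theorem residue_commutator (α β : ℂ) (m n : ℤ) (a b c : V) :
    A.residue α m a (A.residue β n b c) - A.residue β n b (A.residue α m a c) =
      ∑ᶠ s : ℕ, ∑ q ∈ antidiagonal s, (Ring.choose α q.1 * Ring.choose (m : ℂ) q.2) •
        A.residue (α + β - q.1) (m + n - q.2) (A.mode a s b) c := by
  have h := A.residue_jacobi α β 0 m n a b c
  have h0 : ∀ i : ℕ, i ≠ 0 → Ring.choose ((0 : ℤ) : ℂ) i = 0 := by
    intro i hi
    rw [Int.cast_zero, Ring.choose_zero_pos _ (Nat.pos_of_ne_zero hi)]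
  rw [finsum_eq_single _ 0 (fun i hi => by rw [h0 i hi, mul_zero, zero_smul]),
    finsum_eq_single _ 0 (fun i hi => by rw [h0 i hi, mul_zero, zero_smul])] at h
  simpa using h

/-- The case `m = 0`: the factor `z₁^m` is `1`, so only its constant term contributes. -/
theorem residue_iterate (α β : ℂ) (l n : ℤ) (a b c : V) :
    ∑ᶠ s : ℕ, Ring.choose α s • A.residue (α + β - s) n (A.mode a (l + s) b) c =
    (∑ᶠ i : ℕ, ((-1 : ℂ) ^ i * Ring.choose (l : ℂ) i) •
        A.residue α (l - i) a (A.residue β (n + i) b c)) -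
      ((Int.negOnePow l : ℤ) : ℂ) • (∑ᶠ i : ℕ, ((-1 : ℂ) ^ i * Ring.choose (l : ℂ) i) •
        A.residue β (n + l - i) b (A.residue α i a c)) := by
  have h := A.residue_jacobi α β l 0 n a b c
  simp only [zero_add] at h
  rw [h]
  refine finsum_congr fun s => ?_
  rw [Finset.sum_eq_single (s, 0)]
  · simp
  · rintro ⟨i, j⟩ hij hne
    rw [mem_antidiagonal] at hij
    have hj : 0 < j := by
      by_contra hj
      refine hne ?_
      have : j = 0 := by lia
      subst this
      simpa using hij
    rw [Int.cast_zero, Ring.choose_zero_pos _ hj, mul_zero, zero_smul]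
  · intro h
    exact absurd (mem_antidiagonal.2 (add_zero s)) h

/-- The hypothesis on `α + β` makes `α + β - i` the weight of `a_{l+i} b`, so the product of each of
these modes with `c` is the residue in the iterate formula. It lets `α` be prescribed by `a` and
then fixes `β`. -/
theorem star_residue (hg : IsOfFinOrder g) {n q : ℤ} {r s : ℕ} {a b : V} (ha : a ∈ A.wt n)
    (hb : b ∈ A.wt q) (ha' : a ∈ A.eigen g r) (hb' : b ∈ A.eigen g s)
    (hrs : (r + s) % orderOf g = 0) (α β : ℂ) (l : ℤ) (h : α + β = n + q - l - 1) (c : V) :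
    A.star g (A.residue α l a b) c =
    (∑ᶠ i : ℕ, ((-1 : ℂ) ^ i * Ring.choose (l : ℂ) i) •
        A.residue α (l - i) a (A.residue β (-1 + i) b c)) -
      ((Int.negOnePow l : ℤ) : ℂ) • (∑ᶠ i : ℕ, ((-1 : ℂ) ^ i * Ring.choose (l : ℂ) i) •
        A.residue β (-1 + l - i) b (A.residue α i a c)) := by
  rw [← residue_iterate, ← LinearMap.flip_apply, residue_apply,
    map_finsum _ (A.residue_finite α l a b)]
  refine finsum_congr fun i => ?_
  rw [LinearMap.flip_apply, map_smul, LinearMap.smul_apply]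
  have h1 : A.mode a (l + i) b ∈ A.eigen g 0 := by
    rw [← hrs, eigen_mod g hg]
    exact mode_mem_eigen g ha' hb' _
  rw [A.star_eq_residue hg (A.mode_mem_wt ha hb (l + i) rfl) h1,
    show ((n + q - (l + i) - 1 : ℤ) : ℂ) = α + β - i by rw [h]; push_cast; ring]

theorem star_mem_Og_right (hg : IsOfFinOrder g) (c : V) {x : V} (hx : x ∈ A.Og g) :
    A.star g c x ∈ A.Og g := by
  induction c using homogeneous_induction hg with
  | add u v hu hv =>
    rw [map_add, LinearMap.add_apply]
    exact Submodule.add_mem _ hu hv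
  | smul t u hu =>
    rw [map_smul, LinearMap.smul_apply]
    exact Submodule.smul_mem _ _ hu
  | h p t c ht hp hc =>
    by_cases h0 : t = 0
    swap
    · rw [A.star_apply_pos g (Nat.pos_of_ne_zero h0) ht hc]
      exact Submodule.zero_mem _
    subst h0
    have key : A.Og g ≤ (A.Og g).comap (A.star g c) := by
      refine Submodule.span_le.2 ?_
      rintro _ ⟨n, r, a, b, hr, hn, ha, rfl⟩
      rw [SetLike.mem_coe, Submodule.mem_comap, A.star_eq_residue hg hp hc, circ]
      rw [← sub_add_cancel (A.residue _ _ _ _)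
        (A.residue (n - 1 + (if r = 0 then 1 else 0) + r / orderOf g)
          (-1 - (if r = 0 then 1 else 0)) a (A.residue p (-1) c b)), residue_commutator]
      refine Submodule.add_mem _ (Submodule.finsum_mem' _ fun s => Submodule.sum_mem _ fun q hq =>
        Submodule.smul_mem _ _ ?_) (Submodule.subset_span ⟨n, r, a, _, hr, hn, ha, rfl⟩)
      rw [mem_antidiagonal] at hq
      have h1 := mode_mem_eigen g hc ha (s : ℤ)
      rw [zero_add] at h1
      -- The commutator term has `q.2 + 1` extra poles, and its exponent exceeds that of `∘_g` for
      -- `c_s a` by `s - q.1 + 1 = q.2 + 1`: exactly the extreme case allowed.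
      refine residue_mem_Og hr (A.mode_mem_wt hp hn s rfl) h1 b (q.2 + 1) (q.2 + 1) le_rfl ?_ ?_
      · rw [← hq]
        push_cast
        ring
      · push_cast
        ring
    exact key hx

theorem star_mem_Og_left (hg : IsOfFinOrder g) {x : V} (hx : x ∈ A.Og g) (c : V) :
    A.star g x c ∈ A.Og g := by
  have key : A.Og g ≤ (A.Og g).comap ((A.star g).flip c) := by
    refine Submodule.span_le.2 ?_
    rintro _ ⟨n, r, a, b, hr, hn, ha, rfl⟩
    rw [SetLike.mem_coe, Submodule.mem_comap, LinearMap.flip_apply, circ]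
    induction b using homogeneous_induction hg with
    | add u v hu hv =>
      rw [map_add, map_add, LinearMap.add_apply]
      exact Submodule.add_mem _ hu hv
    | smul t u hu =>
      rw [map_smul, map_smul, LinearMap.smul_apply]
      exact Submodule.smul_mem _ _ hu
    | h q s b hs hq hb =>
      by_cases hrs : (r + s) % orderOf g = 0
      swap
      · rw [star_eq_zero_of_mod_ne hg hrs (residue_mem_eigen ha hb _ _)]
        exact Submodule.zero_mem _
      have hT : (orderOf g : ℂ) ≠ 0 := by exact_mod_cast hg.orderOf_pos.ne'
      by_cases h0 : r = 0
      · subst h0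
        have : s = 0 := by rwa [zero_add, Nat.mod_eq_of_lt hs] at hrs
        subst this
        -- `α = n` comes from `∘_g`, which forces `β = q + 1`. The excess `1` over the weight of `b`
        -- is absorbed by the additional poles in the second sum.
        rw [star_residue hg hn hq ha hb hrs _ (q + 1) _ (by push_cast; ring)]
        refine Submodule.sub_mem _ (Submodule.finsum_mem' _ fun i => Submodule.smul_mem _ _ ?_)
          (Submodule.smul_mem _ _ (Submodule.finsum_mem' _ fun i => Submodule.smul_mem _ _ ?_))
        · exact residue_mem_Og_zero hg hn ha _ 0 i (by lia) (by simp) (by simp)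
        · refine residue_mem_Og_zero hg hq hb _ 1 (i + 1) (by lia) (by simp) ?_
          simp
          ring
      -- As `0 < r + s < 2T`, divisibility by `T` leaves only `T`; so `b` lies in `V^{T-r}`, whose
      -- exponent `s/T` complements `r/T`.
      · have hsum : r + s = orderOf g := by
          obtain ⟨d, hd⟩ := Nat.dvd_of_mod_eq_zero hrs
          have h2 : d = 1 := by
            have h3 : orderOf g * d < orderOf g * 2 := by lia
            have h4 : d < 2 := lt_of_mul_lt_mul_left h3 (Nat.zero_le _)
            have h5 : d ≠ 0 := by
              rintro rfl
              lia
            lia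
          rw [hd, h2, mul_one]
        have hs0 : s ≠ 0 := by lia
        have hsr : (s : ℂ) / orderOf g = 1 - r / orderOf g := by
          rw [← hsum] at hT ⊢
          field_simp
          push_cast
          ring
        rw [star_residue hg hn hq ha hb hrs _ (q + 1 - r / orderOf g) _ (by simp [h0])]
        refine Submodule.sub_mem _ (Submodule.finsum_mem' _ fun i => Submodule.smul_mem _ _ ?_)
          (Submodule.smul_mem _ _ (Submodule.finsum_mem' _ fun i => Submodule.smul_mem _ _ ?_))
        · exact residue_mem_Og_pos h0 hr hn ha _ 0 i (by lia) (by simp [h0]) (by simp [h0])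
        · refine residue_mem_Og_pos hs0 hs hq hb _ 1 (i + 1) (by lia) ?_ ?_
          · rw [hsr]
            push_cast
            ring
          · simp [h0]
            ring
  exact key hx

end Automorphism

end VertexOperatorAlgebra

/-! ### Associativity, the unit and the centrality of `ω` modulo `O_g(V)`. -/

theorem finsum_sub_apply_zero_mem {V : Type*} [AddCommGroup V] [Module ℂ V] (S : Submodule ℂ V)
    {f : ℕ → V} {N : ℕ} (hf : ∀ i, N ≤ i → f i = 0) (h : ∀ i, f (i + 1) ∈ S) :
    ∑ᶠ i, f i - f 0 ∈ S := by
  rw [finsum_eq_sum_range (N := N + 1) fun i hi => hf i (by lia), Finset.sum_range_succ',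
    add_sub_cancel_right]
  exact Submodule.sum_mem _ fun i _ => h i

namespace VertexOperatorAlgebra

variable {V : Type*} [AddCommGroup V] [Module ℂ V] {A : VertexOperatorAlgebra V} {g : A.Aut}

theorem star_assoc_sub_mem (hg : IsOfFinOrder g) (a b c : V) :
    A.star g (A.star g a b) c - A.star g a (A.star g b c) ∈ A.Og g := by
  induction a using homogeneous_induction hg with
  | add u v hu hv =>
    simp only [map_add, LinearMap.add_apply]
    rw [add_sub_add_comm]
    exact Submodule.add_mem _ hu hv
  | smul t u hu =>
    simp only [map_smul, LinearMap.smul_apply]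
    rw [← smul_sub]
    exact Submodule.smul_mem _ _ hu
  | h n r a hr hn ha =>
  by_cases h0 : r = 0
  swap
  · simp [A.star_apply_pos g (Nat.pos_of_ne_zero h0) hr ha]
  subst h0
  induction b using homogeneous_induction hg with
  | add u v hu hv =>
    simp only [map_add, LinearMap.add_apply]
    rw [add_sub_add_comm]
    exact Submodule.add_mem _ hu hv
  | smul t u hu =>
    simp only [map_smul, LinearMap.smul_apply]
    rw [← smul_sub]
    exact Submodule.smul_mem _ _ hu
  | h q s b hs hq hb =>
  by_cases h0 : s = 0
  swap
  · have hab := residue_mem_eigen ha hb n (-1)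
    rw [zero_add] at hab
    rw [A.star_eq_residue hg hn ha, A.star_apply_pos g (Nat.pos_of_ne_zero h0) hs hab,
      A.star_apply_pos g (Nat.pos_of_ne_zero h0) hs hb, map_zero, sub_zero]
    exact Submodule.zero_mem _
  subst h0
  rw [A.star_eq_residue hg hn ha, A.star_eq_residue hg hn ha, A.star_eq_residue hg hq hb,
    star_residue hg hn hq ha hb (Nat.zero_mod _) n q (-1) (by push_cast; ring), sub_right_comm]
  refine Submodule.sub_mem _ ?_
    (Submodule.smul_mem _ _ (Submodule.finsum_mem' _ fun i => Submodule.smul_mem _ _ ?_))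
  -- The term `i = 0` is `a * (b * c)`; the others carry a pole of order at least two in `a`.
  · obtain ⟨M, hM⟩ := A.residue_eventually_zero q b c
    have := finsum_sub_apply_zero_mem (A.Og g) (N := (M + 1).toNat)
      (f := fun i : ℕ => ((-1 : ℂ) ^ i * Ring.choose ((-1 : ℤ) : ℂ) i) •
        A.residue n (-1 - i) a (A.residue q (-1 + i) b c)) ?_ ?_
    · simpa using this
    · intro i hi
      rw [hM _ (by lia), map_zero, smul_zero]
    · intro i
      refine Submodule.smul_mem _ _ (residue_mem_Og_zero hg hn ha _ 0 i (by lia) (by simp) ?_)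
      push_cast
      ring
  · exact residue_mem_Og_zero hg hq hb _ 0 i (by lia) (by simp) (by ring)

theorem L_neg_one_eq_mode_vacuum (w : V) : A.L (-1) w = A.mode w (-2) A.vacuum := by
  rw [← A.creation (A.L (-1) w)]
  change A.mode _ _ _ = _
  rw [L_neg_one_mode]
  simp

/-- The element is `w ∘_g 𝟏`: only the modes `w_{-2}` and `w_{-1}` contribute on the vacuum. -/
theorem L_neg_one_add_mem (hg : IsOfFinOrder g) {p : ℤ} {w : V} (hp : w ∈ A.wt p)
    (hw : w ∈ A.eigen g 0) : A.L (-1) w + (p : ℂ) • w ∈ A.Og g := by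
  have h := residue_mem_Og_zero hg hp hw A.vacuum (k := -2) 0 0 le_rfl rfl (by simp)
  have h1 : ∀ n : ℤ, -2 + (2 : ℕ) ≤ n → A.mode w n A.vacuum = 0 :=
    fun n hn => A.creation_nonneg w n (by lia)
  rw [A.residue_eq_sum_range h1] at h
  have h2 : A.mode w (-1) A.vacuum = w := A.creation w
  simpa [Finset.sum_range_succ, h2, L_neg_one_eq_mode_vacuum] using h

/-- The coefficient form of `e^{zL(-1)}w ≡ (1+z)^{-p} w`. The induction passes to `L(-1)w`, using
`(i+1) w_{-2-i} = (L(-1)w)_{-1-i}`. -/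
theorem mode_vacuum_sub_mem (hg : IsOfFinOrder g) {p : ℤ} {w : V} (hp : w ∈ A.wt p)
    (hw : w ∈ A.eigen g 0) (i : ℕ) :
    A.mode w (-1 - i) A.vacuum - Ring.choose (-p : ℂ) i • w ∈ A.Og g := by
  induction i generalizing p w with
  | zero => simp [A.creation]
  | succ i ih =>
    have h1 := ih (A.L_neg_one_mem hp) (L_mem_eigen g hw _)
    have h2 := (A.Og g).smul_mem (Ring.choose (-(p + 1 : ℤ) : ℂ) i) (L_neg_one_add_mem hg hp hw)
    have hne : (i : ℂ) + 1 ≠ 0 := by exact_mod_cast Nat.succ_ne_zero i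
    rw [← Submodule.smul_mem_iff _ hne]
    convert (A.Og g).add_mem h1 h2 using 1
    rw [L_neg_one_mode, LinearMap.smul_apply, smul_sub, smul_smul, succ_mul_choose_succ,
      show -1 - ((i + 1 : ℕ) : ℤ) = -1 - i - 1 by push_cast; ring,
      show ((-(p + 1 : ℤ)) : ℂ) = -p - 1 by push_cast; ring]
    push_cast
    module

theorem residue_vacuum_sub_mem (hg : IsOfFinOrder g) {p : ℤ} {w : V} (hp : w ∈ A.wt p)
    (hw : w ∈ A.eigen g 0) (α : ℂ) (j : ℕ) :
    A.residue α (-1 - j) w A.vacuum - Ring.choose (α - p) j • w ∈ A.Og g := by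
  have h1 : ∀ n : ℤ, -1 - j + (j + 1 : ℕ) ≤ n → A.mode w n A.vacuum = 0 :=
    fun n hn => A.creation_nonneg w n (by lia)
  rw [A.residue_eq_sum_range h1, sub_eq_add_neg α, Ring.add_choose_eq _ (Commute.all _ _),
    Finset.Nat.sum_antidiagonal_eq_sum_range_succ
      (fun i k => Ring.choose α i * Ring.choose (-p : ℂ) k), Finset.sum_smul,
    ← Finset.sum_sub_distrib]
  refine Submodule.sum_mem _ fun i hi => ?_
  rw [Finset.mem_range] at hi
  rw [mul_smul, ← smul_sub, show -1 - (j : ℤ) + i = -1 - ((j - i : ℕ) : ℤ) by lia]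
  exact Submodule.smul_mem _ _ (mode_vacuum_sub_mem hg hp hw _)

theorem star_vacuum_right (hg : IsOfFinOrder g) {n : ℤ} {u : V} (hn : u ∈ A.wt n)
    (hu : u ∈ A.eigen g 0) : A.star g u A.vacuum = u := by
  rw [A.star_eq_residue hg hn hu, residue_neg_one_vacuum]

theorem star_sub_star_sub_residue_mem (hg : IsOfFinOrder g) {n q : ℤ} {a b : V} (ha : a ∈ A.wt n)
    (hb : b ∈ A.wt q) (ha' : a ∈ A.eigen g 0) (hb' : b ∈ A.eigen g 0) :
    A.star g a b - A.star g b a - A.residue (n - 1) 0 a b ∈ A.Og g := by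
  -- Writing `b = b_{-1}𝟏` and `a = a_{-1}𝟏` as residues on the vacuum turns the difference of
  -- products into a commutator of operators applied to `𝟏`.
  have h1 : A.star g a b - A.star g b a = A.residue n (-1) a (A.residue q (-1) b A.vacuum) -
      A.residue q (-1) b (A.residue n (-1) a A.vacuum) := by
    rw [residue_neg_one_vacuum, residue_neg_one_vacuum, A.star_eq_residue hg ha ha',
      A.star_eq_residue hg hb hb']
  obtain ⟨M, hM⟩ := A.mode_eventually_zero a b
  rw [h1, residue_commutator, residue_apply, finsum_eq_sum_range (N := M.toNat),
    finsum_eq_sum_range (N := M.toNat), ← Finset.sum_sub_distrib]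
  · refine Submodule.sum_mem _ fun s _ => ?_
    rw [sub_eq_add_neg (n : ℂ), Ring.add_choose_eq _ (Commute.all _ _), Finset.sum_smul,
      ← Finset.sum_sub_distrib]
    refine Submodule.sum_mem _ fun r hr => ?_
    rw [mem_antidiagonal] at hr
    have hmem : A.mode a s b ∈ A.eigen g 0 := mode_mem_eigen g ha' hb' s
    have h2 := residue_vacuum_sub_mem hg (A.mode_mem_wt ha hb s rfl) hmem (n + q - r.1) (r.2 + 1)
    -- The exponent exceeds the weight of `a_s b` by exactly the order `r.2 + 1`, so the binomial
    -- coefficient is `1`. What remains is Vandermonde for `n - 1 = n + (-1)`.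
    have h3 : (n + q - r.1 - ((n + q - s - 1 : ℤ) : ℂ)) = ((r.2 + 1 : ℕ) : ℂ) := by
      rw [← hr]
      push_cast
      ring
    rw [h3, Ring.choose_natCast, Nat.choose_self, Nat.cast_one, one_smul] at h2
    rw [zero_add, show (-1 + -1 - r.2 : ℤ) = -1 - ((r.2 + 1 : ℕ) : ℤ) by push_cast; ring,
      Int.cast_neg, Int.cast_one, ← smul_sub]
    exact Submodule.smul_mem _ _ h2
  · intro i hi
    rw [hM _ (by lia), smul_zero]
  · intro i hi
    rw [hM _ (by lia)]
    simp

/-- `(1+z)^n/z - (1+z)^{n-1} = (1+z)^{n-1}/z`, combined with the commutator formula. -/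
theorem residue_sub_star_mem (hg : IsOfFinOrder g) {n q : ℤ} {a b : V} (ha : a ∈ A.wt n)
    (hb : b ∈ A.wt q) (ha' : a ∈ A.eigen g 0) (hb' : b ∈ A.eigen g 0) :
    A.residue (n - 1) (-1) a b - A.star g b a ∈ A.Og g := by
  have h := star_sub_star_sub_residue_mem hg ha hb ha' hb'
  have h1 := A.residue_add_one (n - 1) (-1) a b
  rw [sub_add_cancel, neg_add_cancel] at h1
  rw [A.star_eq_residue hg ha ha', h1] at h
  convert h using 1
  abel

theorem vacuum_star (hg : IsOfFinOrder g) (x : V) : A.star g A.vacuum x = x := by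
  rw [A.star_eq_residue hg A.vacuum_mem (vacuum_mem_eigen g), residue_apply,
    finsum_eq_single _ 0]
  · simp [mode, A.vacuum_mode]
  · intro i hi
    rw [mode, A.vacuum_mode, if_neg (by lia), smul_zero]

theorem star_vacuum_sub_mem (hg : IsOfFinOrder g) (x : V) :
    A.star g x A.vacuum - x ∈ A.Og g := by
  induction x using homogeneous_induction hg with
  | add u v hu hv =>
    rw [map_add, LinearMap.add_apply, add_sub_add_comm]
    exact Submodule.add_mem _ hu hv
  | smul t u hu =>
    rw [map_smul, LinearMap.smul_apply, ← smul_sub]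
    exact Submodule.smul_mem _ _ hu
  | h n r u hr hn hu =>
    by_cases h0 : r = 0
    · subst h0
      rw [star_vacuum_right hg hn hu, sub_self]
      exact Submodule.zero_mem _
    · rw [A.star_apply_pos g (Nat.pos_of_ne_zero h0) hr hu, zero_sub, Submodule.neg_mem_iff]
      exact mem_Og_of_mem_eigen h0 hr hn hu

theorem residue_mem_Og_of_pos {n q : ℤ} {r : ℕ} (h0 : r ≠ 0) (hr : r < orderOf g) {a b : V}
    (ha : a ∈ A.wt n) (hb : b ∈ A.wt q) (ha' : a ∈ A.eigen g 0) (hb' : b ∈ A.eigen g r)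
    (α : ℂ) (k : ℤ) : A.residue α k a b ∈ A.Og g := by
  refine A.residue_mem _ (fun m => mem_Og_of_mem_eigen h0 hr (A.mode_mem_wt ha hb m rfl) ?_) α k
  have := mode_mem_eigen g ha' hb' m
  rwa [zero_add] at this

theorem omega_star_sub_mem (hg : IsOfFinOrder g) (x : V) :
    A.star g A.omega x - A.star g x A.omega ∈ A.Og g := by
  induction x using homogeneous_induction hg with
  | add u v hu hv =>
    rw [map_add, map_add, LinearMap.add_apply, add_sub_add_comm]
    exact Submodule.add_mem _ hu hv
  | smul t u hu =>
    rw [map_smul, map_smul, LinearMap.smul_apply, ← smul_sub]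
    exact Submodule.smul_mem _ _ hu
  | h n r u hr hn hu =>
    by_cases h0 : r = 0
    · subst h0
      have h := star_sub_star_sub_residue_mem hg A.omega_mem hn (omega_mem_eigen g) hu
      refine (Submodule.sub_mem_iff_left _ ?_).1 h
      have h1 : A.residue ((2 : ℤ) - 1) 0 A.omega u = A.L (-1) u + (n : ℂ) • u := by
        rw [← A.L_zero_apply hn, residue_apply, finsum_eq_sum_range (N := 2)]
        · rw [show ((2 : ℤ) : ℂ) - 1 = 1 by norm_num]
          simp [Finset.sum_range_succ, L]
        · intro i hi
          have := Ring.choose_natCast (R := ℂ) 1 i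
          rw [Nat.choose_eq_zero_of_lt (by lia), Nat.cast_one] at this
          rw [show ((2 : ℤ) : ℂ) - 1 = 1 by norm_num, this, Nat.cast_zero, zero_smul]
      rw [h1]
      exact L_neg_one_add_mem hg hn hu
    · rw [A.star_apply_pos g (Nat.pos_of_ne_zero h0) hr hu, sub_zero,
        A.star_eq_residue hg A.omega_mem (omega_mem_eigen g)]
      exact residue_mem_Og_of_pos h0 hr A.omega_mem hn (omega_mem_eigen g) hu _ _

end VertexOperatorAlgebra

/-! ### Conjugation by `e^{L(1)}` and the involution `φ`. -/

theorem sum_antidiagonal_succ_add {M : Type*} [AddCommMonoid M] (u v : ℕ → ℕ → M)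
    (hu : ∀ j, u 0 j = 0) (hv : ∀ k, v k 0 = 0) (N : ℕ) :
    ∑ q ∈ antidiagonal (N + 1), (u q.1 q.2 + v q.1 q.2) =
      ∑ q ∈ antidiagonal N, (u (q.1 + 1) q.2 + v q.1 (q.2 + 1)) := by
  rw [Finset.sum_add_distrib, Finset.sum_add_distrib]
  congr 1
  · rw [Finset.Nat.sum_antidiagonal_succ (f := fun q => u q.1 q.2), hu, zero_add]
  · rw [Finset.Nat.sum_antidiagonal_succ' (f := fun q => v q.1 q.2), hv, zero_add]

theorem sum_antidiagonal_inv_factorial (N : ℕ) :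
    ∑ q ∈ antidiagonal N, ((q.1.factorial : ℂ)⁻¹ * ((q.2.factorial : ℂ)⁻¹ * (-1) ^ q.2)) =
      if N = 0 then 1 else 0 := by
  have hN : (N.factorial : ℂ) ≠ 0 := by exact_mod_cast N.factorial_ne_zero
  have h := (Commute.all (1 : ℂ) (-1)).add_pow' N
  rw [add_neg_cancel] at h
  have h1 : ∑ q ∈ antidiagonal N, ((q.1.factorial : ℂ)⁻¹ * ((q.2.factorial : ℂ)⁻¹ * (-1) ^ q.2)) =
      (N.factorial : ℂ)⁻¹ * (0 : ℂ) ^ N := by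
    rw [h, Finset.mul_sum]
    refine Finset.sum_congr rfl fun q hq => ?_
    rw [mem_antidiagonal] at hq
    have h2 : (N.choose q.1 : ℂ) = N.factorial / (q.1.factorial * q.2.factorial) := by
      rw [← hq, Nat.cast_add_choose]
    rw [nsmul_eq_mul, h2, one_pow]
    have h3 : (q.1.factorial : ℂ) ≠ 0 := by exact_mod_cast q.1.factorial_ne_zero
    have h4 : (q.2.factorial : ℂ) ≠ 0 := by exact_mod_cast q.2.factorial_ne_zero
    field_simp
  rw [h1]
  split_ifs with h0
  · simp [h0]
  · simp [h0]

namespace VertexOperatorAlgebra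

variable {V : Type*} [AddCommGroup V] [Module ℂ V] (A : VertexOperatorAlgebra V)

/-- The operator `(ad L(1))^M a_n / M!` for `a` of weight `p`. -/
def adLPow (p : ℤ) (a : V) (n : ℤ) (M : ℕ) : Module.End ℂ V :=
  ∑ q ∈ antidiagonal M, ((q.2.factorial : ℂ)⁻¹ * Ring.choose (2 * p - q.2 - n - 2 : ℂ) q.1) •
    A.mode ((A.L 1 ^ q.2) a) (n + q.1)

theorem L_one_adLPow {p : ℤ} {a : V} (ha : a ∈ A.wt p) (n : ℤ) (M : ℕ) (w : V) :
    A.L 1 (A.adLPow p a n M w) =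
      A.adLPow p a n M (A.L 1 w) + ((M : ℂ) + 1) • A.adLPow p a n (M + 1) w := by
  simp only [adLPow, LinearMap.sum_apply, LinearMap.smul_apply, map_sum, map_smul]
  rw [← sub_eq_iff_eq_add', ← Finset.sum_sub_distrib]
  -- The coefficient `M + 1 = k + j` is split into the part obtained by raising the mode index `k`
  -- and the part obtained by raising the power `j` of `L(1)`. The second is read off from
  -- `L_one_mode`, the first is the remainder; Pascal's rule identifies it.
  have h := sum_antidiagonal_succ_add
    (fun k j => ((j.factorial : ℂ)⁻¹ * ((j + k) * Ring.choose (2 * p - j - n - 2 : ℂ) k -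
      j * Ring.choose (2 * p - j - n - 2 + 1 : ℂ) k)) • A.mode ((A.L 1 ^ j) a) (n + k) w)
    (fun k j => ((j.factorial : ℂ)⁻¹ * (j * Ring.choose (2 * p - j - n - 2 + 1 : ℂ) k)) •
      A.mode ((A.L 1 ^ j) a) (n + k) w) (by simp) (by simp) M
  convert h.symm using 1
  · refine Finset.sum_congr rfl fun q _ => ?_
    rw [← smul_sub, A.L_one_mode _ _ _ (A.L_one_pow_mem ha q.2)]
    have h1 := succ_mul_choose_succ' (2 * p - q.2 - n - 2 : ℂ) q.1
    have h2 := choose_succ_succ_add (2 * p - q.2 - n - 2 : ℂ) q.1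
    have h3 : (((q.2 + 1).factorial : ℕ) : ℂ)⁻¹ * ((q.2 : ℂ) + 1) = (q.2.factorial : ℂ)⁻¹ := by
      rw [Nat.factorial_succ]
      have : (q.2.factorial : ℂ) ≠ 0 := by exact_mod_cast q.2.factorial_ne_zero
      have : (q.2 : ℂ) + 1 ≠ 0 := by exact_mod_cast Nat.succ_ne_zero q.2
      push_cast
      field_simp
    have h4 : ((q.2 : ℂ) + ((q.1 + 1 : ℕ) : ℂ)) * Ring.choose (2 * p - q.2 - n - 2 : ℂ) (q.1 + 1) -
        q.2 * Ring.choose (2 * p - q.2 - n - 2 + 1 : ℂ) (q.1 + 1) =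
        (2 * ((p - q.2 : ℤ) : ℂ) - ((n + q.1 : ℤ) : ℂ) - 2) *
          Ring.choose (2 * p - q.2 - n - 2 : ℂ) q.1 := by
      rw [h2]
      push_cast
      linear_combination h1
    rw [h4, ← mul_assoc ((q.2 + 1).factorial : ℂ)⁻¹, Nat.cast_succ q.2, h3, pow_succ',
      Module.End.mul_apply, show n + ((q.1 + 1 : ℕ) : ℤ) = n + q.1 + 1 by push_cast; ring,
      show (2 * p - (q.2 + 1 : ℂ) - n - 2 + 1 : ℂ) = 2 * p - q.2 - n - 2 by ring]
    push_cast
    module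
  · rw [Finset.smul_sum]
    refine Finset.sum_congr rfl fun q hq => ?_
    rw [mem_antidiagonal] at hq
    have : (M : ℂ) + 1 = q.1 + q.2 := by exact_mod_cast hq.symm
    rw [this]
    module

/-- The Leibniz rule in divided powers, by induction from `L_one_adLPow`. -/
theorem L_one_pow_mode {p : ℤ} {a : V} (ha : a ∈ A.wt p) (n : ℤ) (b : V) (N : ℕ) :
    (N.factorial : ℂ)⁻¹ • (A.L 1 ^ N) (A.mode a n b) =
      ∑ q ∈ antidiagonal N, A.adLPow p a n q.1 ((q.2.factorial : ℂ)⁻¹ • (A.L 1 ^ q.2) b) := by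
  have hfac : ∀ k : ℕ, ((k : ℂ) + 1) * (((k + 1).factorial : ℕ) : ℂ)⁻¹ = (k.factorial : ℂ)⁻¹ := by
    intro k
    rw [Nat.factorial_succ]
    have : (k.factorial : ℂ) ≠ 0 := by exact_mod_cast k.factorial_ne_zero
    have : (k : ℂ) + 1 ≠ 0 := by exact_mod_cast Nat.succ_ne_zero k
    push_cast
    field_simp
  induction N with
  | zero => simp [adLPow]
  | succ N ih =>
    have hne : (N : ℂ) + 1 ≠ 0 := by exact_mod_cast Nat.succ_ne_zero N
    apply smul_right_injective V hne
    simp only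
    rw [smul_smul, hfac, pow_succ', Module.End.mul_apply, ← map_smul, ih, map_sum,
      Finset.smul_sum]
    have h := sum_antidiagonal_succ_add
      (fun k j => (k : ℂ) • A.adLPow p a n k ((j.factorial : ℂ)⁻¹ • (A.L 1 ^ j) b))
      (fun k j => (j : ℂ) • A.adLPow p a n k ((j.factorial : ℂ)⁻¹ • (A.L 1 ^ j) b))
      (by simp) (by simp) N
    convert h.symm using 1
    · refine Finset.sum_congr rfl fun q _ => ?_
      rw [A.L_one_adLPow ha, map_smul (A.adLPow p a n q.1) (((q.2 + 1).factorial : ℕ) : ℂ)⁻¹,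
        smul_smul, Nat.cast_succ q.2, hfac, pow_succ', Module.End.mul_apply, map_smul (A.L 1),
        map_smul (A.adLPow p a n q.1), Nat.cast_succ q.1, add_comm]
    · refine Finset.sum_congr rfl fun q hq => ?_
      rw [mem_antidiagonal] at hq
      have : (N : ℂ) + 1 = q.1 + q.2 := by exact_mod_cast hq.symm
      rw [this, add_smul]

theorem exists_mode_L_one_pow_eq_zero (a w : V) (n : ℤ) :
    ∃ K : ℕ, ∀ j t : ℕ, K ≤ j ∨ K ≤ t → A.mode ((A.L 1 ^ j) a) (n + t) w = 0 := by
  obtain ⟨J, hJ⟩ := A.L_one_locally_nilpotent a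
  obtain ⟨K, hK⟩ := A.exists_mode_eq_zero_of_lt (fun j => (A.L 1 ^ j) a) w J
  refine ⟨J + (K - n).toNat, fun j t h => ?_⟩
  by_cases hj : J ≤ j
  · rw [hJ j hj]
    simp [mode, vertexMode]
  · exact hK j (by lia) _ (by lia)

theorem adLPow_eventually_zero (p : ℤ) (a : V) (n : ℤ) (w : V) :
    ∃ K : ℕ, ∀ M, K ≤ M → A.adLPow p a n M w = 0 := by
  obtain ⟨K, hK⟩ := A.exists_mode_L_one_pow_eq_zero a w n
  refine ⟨K + K, fun M hM => ?_⟩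
  rw [adLPow, LinearMap.sum_apply]
  refine Finset.sum_eq_zero fun q hq => ?_
  rw [mem_antidiagonal] at hq
  rw [LinearMap.smul_apply, hK _ _ (by lia), smul_zero]

theorem expL_apply (v : V) : A.expL v = ∑ᶠ j : ℕ, ((j.factorial : ℂ)⁻¹) • (A.L 1 ^ j) v := rfl

theorem expL_mode {p : ℤ} {a : V} (ha : a ∈ A.wt p) (n : ℤ) (b : V) :
    A.expL (A.mode a n b) = ∑ᶠ k : ℕ, ∑ᶠ j : ℕ,
      ((j.factorial : ℂ)⁻¹ * Ring.choose (2 * p - j - n - 2 : ℂ) k) •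
        A.mode ((A.L 1 ^ j) a) (n + k) (A.expL b) := by
  have h1 : A.expL (A.mode a n b) = ∑ᶠ M : ℕ, A.adLPow p a n M (A.expL b) := by
    rw [expL_apply]
    simp only [A.L_one_pow_mode ha]
    obtain ⟨J, hJ⟩ := A.L_one_locally_nilpotent b
    choose K hK using fun j : ℕ => A.adLPow_eventually_zero p a n ((A.L 1 ^ j) b)
    rw [← finsum_finsum_eq_finsum_antidiagonal
      (f := fun i j => A.adLPow p a n i ((j.factorial : ℂ)⁻¹ • (A.L 1 ^ j) b))
      (N := J + (Finset.range J).sup K)]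
    · refine finsum_congr fun M => ?_
      rw [expL_apply, map_finsum _ (A.exp_finite b)]
    · intro i j hij
      rw [map_smul]
      by_cases hj : J ≤ j
      · rw [hJ j hj, map_zero, smul_zero]
      · have : K j ≤ (Finset.range J).sup K :=
          Finset.le_sup (f := K) (Finset.mem_range.2 (by lia))
        rw [hK j i (by lia), smul_zero]
  obtain ⟨K, hK⟩ := A.exists_mode_L_one_pow_eq_zero a (A.expL b) n
  rw [h1, finsum_finsum_eq_finsum_antidiagonal (N := K + K)]
  · refine finsum_congr fun M => ?_
    rw [adLPow, LinearMap.sum_apply]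
    rfl
  · intro i j hij
    rw [hK _ _ (by lia), smul_zero]

/-- Conjugation of a residue by `e^{L(1)}`. -/
theorem finsum_expL_mode {p : ℤ} {a : V} (ha : a ∈ A.wt p) (α : ℂ) (m : ℤ) (b : V) :
    ∑ᶠ i : ℕ, ((-1 : ℂ) ^ i * Ring.choose α i) • A.expL (A.mode a (m + i) b) =
      ∑ᶠ j : ℕ, (j.factorial : ℂ)⁻¹ •
        A.residue (2 * p - j - m - 2 - α) m ((A.L 1 ^ j) a) (A.expL b) := by
  obtain ⟨K, hK⟩ := A.exists_mode_L_one_pow_eq_zero a (A.expL b) m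
  simp only [A.expL_mode ha, smul_finsum]
  have hz : ∀ i k j : ℕ, K ≤ i + k ∨ K ≤ j →
      A.mode ((A.L 1 ^ j) a) (m + i + k) (A.expL b) = 0 := by
    intro i k j h
    rw [add_assoc, ← Nat.cast_add]
    exact hK _ _ (by lia)
  rw [finsum_rotate_of_bound (N := K)]
  · refine finsum_congr fun j => ?_
    rw [finsum_finsum_eq_finsum_antidiagonal (N := K), residue_apply, smul_finsum]
    · refine finsum_congr fun s => ?_
      rw [← sum_antidiagonal_neg_one_pow_choose, Finset.sum_smul, Finset.smul_sum]
      refine Finset.sum_congr rfl fun q hq => ?_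
      rw [mem_antidiagonal] at hq
      rw [smul_smul, smul_smul, ← hq]
      push_cast
      rw [add_assoc, show (2 * p - j - (m + q.1) - 2 : ℂ) = 2 * p - j - m - 2 - q.1 by ring]
      congr 1
      ring
    · intro i k hik
      rw [hz _ _ _ (.inl hik), smul_zero, smul_zero]
  · intro i k j h
    rw [hz _ _ _ (by lia), smul_zero, smul_zero]

theorem signL_apply {n : ℤ} {v : V} (hv : v ∈ A.wt n) : A.signL v = (-1 : ℂ) ^ n • v := by
  rw [signL, A.extendByWeight_apply _ hv]
  simp

theorem phi_apply {n : ℤ} {v : V} (hv : v ∈ A.wt n) : A.phi v = (-1 : ℂ) ^ n • A.expL v := by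
  rw [phi, LinearMap.comp_apply, A.signL_apply hv, map_smul]

/-- `(-1)^{L(0)}` replaces `(1+z)^α` by `(1-z)^α` up to a global sign, the form needed to conjugate
by `e^{L(1)}`. -/
theorem phi_residue {p q : ℤ} {a b : V} (ha : a ∈ A.wt p) (hb : b ∈ A.wt q) (α : ℂ) (m : ℤ) :
    A.phi (A.residue α m a b) = (-1 : ℂ) ^ (p - m - 1) • ∑ᶠ j : ℕ, (j.factorial : ℂ)⁻¹ •
      A.residue (2 * p - j - m - 2 - α) m ((A.L 1 ^ j) a) (A.phi b) := by
  have h1 : (-1 : ℂ) ≠ 0 := by norm_num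
  rw [residue_apply, map_finsum _ (A.residue_finite α m a b)]
  simp only [map_smul, A.phi_apply hb]
  simp only [smul_comm _ ((-1 : ℂ) ^ q), ← smul_finsum]
  rw [← A.finsum_expL_mode ha]
  simp only [smul_finsum]
  refine finsum_congr fun i => ?_
  rw [A.phi_apply (A.mode_mem_wt ha hb (m + i) rfl), smul_smul, smul_smul, smul_smul]
  congr 1
  have h2 : (-1 : ℂ) ^ (p + q - (m + i) - 1) = (-1) ^ (p - m - 1) * (-1) ^ q * (-1) ^ i := by
    rw [← zpow_add₀ h1, show p + q - (m + i) - 1 = p - m - 1 + q - i by ring, zpow_sub₀ h1,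
      div_eq_mul_inv, zpow_natCast, ← inv_pow, inv_neg, inv_one]
  rw [h2]
  ring

/-- `L(1)` lowers weights by one, so conjugating `e^{L(1)}` by `(-1)^{L(0)}` gives `e^{-L(1)}`. -/
theorem phi_phi_of_mem_wt {n : ℤ} {v : V} (hv : v ∈ A.wt n) : A.phi (A.phi v) = v := by
  have h1 : (-1 : ℂ) ≠ 0 := by norm_num
  obtain ⟨J, hJ⟩ := A.L_one_locally_nilpotent v
  rw [A.phi_apply hv, map_smul, expL_apply, map_finsum _ (A.exp_finite v)]
  have h2 : ∀ j : ℕ, A.phi ((j.factorial : ℂ)⁻¹ • (A.L 1 ^ j) v) = ∑ᶠ i : ℕ,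
      ((-1 : ℂ) ^ n * ((i.factorial : ℂ)⁻¹ * ((j.factorial : ℂ)⁻¹ * (-1) ^ j))) •
        (A.L 1 ^ (i + j)) v := by
    intro j
    rw [map_smul, A.phi_apply (A.L_one_pow_mem hv j), expL_apply, smul_finsum, smul_finsum]
    refine finsum_congr fun i => ?_
    rw [pow_add, Module.End.mul_apply, smul_smul, smul_smul, zpow_sub₀ h1, div_eq_mul_inv,
      zpow_natCast, ← inv_pow, inv_neg, inv_one]
    congr 1
    ring
  have hz : ∀ i j : ℕ, J ≤ i + j → ((-1 : ℂ) ^ n * ((i.factorial : ℂ)⁻¹ *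
      ((j.factorial : ℂ)⁻¹ * (-1) ^ j))) • (A.L 1 ^ (i + j)) v = 0 := by
    intro i j hij
    rw [hJ _ hij, smul_zero]
  simp only [h2]
  rw [finsum_comm_of_bound (N := J) fun j i h => hz i j (by lia),
    finsum_finsum_eq_finsum_antidiagonal hz, finsum_eq_single _ 0]
  · rw [Finset.sum_congr rfl fun q hq => by rw [mem_antidiagonal.1 hq], ← Finset.sum_smul,
      ← Finset.mul_sum, sum_antidiagonal_inv_factorial, smul_smul, if_pos rfl, mul_one,
      ← mul_zpow]
    simp
  · intro N hN
    rw [Finset.sum_congr rfl fun q hq => by rw [mem_antidiagonal.1 hq], ← Finset.sum_smul,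
      ← Finset.mul_sum, sum_antidiagonal_inv_factorial, if_neg hN, mul_zero, zero_smul]

theorem phi_mem_of_forall_L_one_pow_mem (S : Submodule ℂ V) {n : ℤ} {v : V} (hv : v ∈ A.wt n)
    (h : ∀ j, (A.L 1 ^ j) v ∈ S) : A.phi v ∈ S := by
  rw [A.phi_apply hv, expL_apply]
  exact S.smul_mem _ (S.finsum_mem' fun j => S.smul_mem _ (h j))

end VertexOperatorAlgebra

/-! ### The anti-isomorphism and the induced products. -/

namespace VertexOperatorAlgebra

variable {V : Type*} [AddCommGroup V] [Module ℂ V] {A : VertexOperatorAlgebra V} {g : A.Aut}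

theorem mem_eigen_inv {r s : ℕ} (hrs : r + s = orderOf g) {u : V} (hu : u ∈ A.eigen g r) :
    u ∈ A.eigen g⁻¹ s := by
  rw [mem_eigen_iff] at *
  rw [orderOf_inv]
  set ζ := Complex.exp (2 * Real.pi * Complex.I / orderOf g) with hζ
  apply g.1.injective
  have h1 : g.1 ((g⁻¹).1 u) = u := g.1.apply_symm_apply u
  have h2 : ζ ^ orderOf g = 1 := by
    by_cases h0 : orderOf g = 0
    · rw [h0, pow_zero]
    · exact (Complex.isPrimitiveRoot_exp _ h0).pow_eq_one
  rw [h1, map_smul, hu, smul_smul, ← pow_add, add_comm s, hrs, h2, one_smul]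

theorem mem_eigen_inv_zero (hg : IsOfFinOrder g) {u : V} (hu : u ∈ A.eigen g 0) :
    u ∈ A.eigen g⁻¹ 0 := by
  rw [← eigen_orderOf g⁻¹ hg.inv, orderOf_inv]
  exact mem_eigen_inv (zero_add _) hu

theorem L_one_pow_mem_eigen {r : ℕ} {a : V} (ha : a ∈ A.eigen g r) (j : ℕ) :
    (A.L 1 ^ j) a ∈ A.eigen g r := by
  induction j with
  | zero => simpa using ha
  | succ j ih =>
    rw [pow_succ', Module.End.mul_apply]
    exact L_mem_eigen g ih 1

theorem phi_phi (hg : IsOfFinOrder g) (v : V) : A.phi (A.phi v) = v := by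
  induction v using homogeneous_induction hg with
  | add u v hu hv => rw [map_add, map_add, hu, hv]
  | smul t u hu => rw [map_smul, map_smul, hu]
  | h n r u hr hn hu => exact A.phi_phi_of_mem_wt hn

theorem phi_mem_Og_inv (hg : IsOfFinOrder g) {x : V} (hx : x ∈ A.Og g) :
    A.phi x ∈ A.Og g⁻¹ := by
  have key : A.Og g ≤ (A.Og g⁻¹).comap A.phi := by
    refine Submodule.span_le.2 ?_
    rintro _ ⟨n, r, a, b, hr, hn, ha, rfl⟩
    rw [SetLike.mem_coe, Submodule.mem_comap, circ]
    induction b using homogeneous_induction hg with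
    | add u v hu hv =>
      rw [map_add, map_add]
      exact Submodule.add_mem _ hu hv
    | smul t u hu =>
      rw [map_smul, map_smul]
      exact Submodule.smul_mem _ _ hu
    | h q s b hs hq hb =>
    rw [A.phi_residue hn hq]
    refine Submodule.smul_mem _ _ (Submodule.finsum_mem' _ fun j => Submodule.smul_mem _ _ ?_)
    by_cases h0 : r = 0
    · subst h0
      refine residue_mem_Og_zero hg.inv (A.L_one_pow_mem hn j)
        (L_one_pow_mem_eigen (mem_eigen_inv_zero hg ha) j) _ 0 0 le_rfl ?_ (by simp)
      push_cast
      simp only [zero_div]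
      ring
    · obtain ⟨s, hrs⟩ := Nat.exists_eq_add_of_le hr.le
      have hT : (orderOf g : ℂ) ≠ 0 := by exact_mod_cast hg.orderOf_pos.ne'
      have hsr : (s : ℂ) / orderOf g = 1 - r / orderOf g := by
        rw [hrs] at hT ⊢
        field_simp
        push_cast
        ring
      refine residue_mem_Og_pos (r := s) (by lia) (by rw [orderOf_inv]; lia)
        (A.L_one_pow_mem hn j) (L_one_pow_mem_eigen (mem_eigen_inv hrs.symm ha) j) _ 0 0 le_rfl ?_
        (by simp [h0])
      -- The reflected exponent is `n - j - r/T = (n - j) - 1 + (T - r)/T`, the one of `∘_{g⁻¹}` for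
      -- `L(1)^j a`.
      rw [orderOf_inv, hsr]
      simp only [h0, if_false]
      push_cast
      ring
  exact key hx

/-- `φ(b)` is not homogeneous, but it is a combination of the homogeneous `L(1)^j b`, and the
congruence is linear in `b`. -/
theorem residue_sub_star_phi_mem (hg : IsOfFinOrder g) {n q : ℤ} {a b : V} (ha : a ∈ A.wt n)
    (hb : b ∈ A.wt q) (ha' : a ∈ A.eigen g 0) (hb' : b ∈ A.eigen g 0) :
    A.residue (n - 1) (-1) a (A.phi b) - A.star g (A.phi b) a ∈ A.Og g :=
  A.phi_mem_of_forall_L_one_pow_mem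
    ((A.Og g).comap (A.residue (n - 1) (-1) a - (A.star g).flip a)) hb fun j =>
      residue_sub_star_mem hg ha (A.L_one_pow_mem hb j) ha' (L_one_pow_mem_eigen hb' j)

theorem phi_star_sub_mem (hg : IsOfFinOrder g) (a b : V) :
    A.phi (A.star g a b) - A.star g⁻¹ (A.phi b) (A.phi a) ∈ A.Og g⁻¹ := by
  induction a using homogeneous_induction hg with
  | add u v hu hv =>
    simp only [map_add, LinearMap.add_apply]
    rw [add_sub_add_comm]
    exact Submodule.add_mem _ hu hv
  | smul t u hu =>
    simp only [map_smul, LinearMap.smul_apply]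
    rw [← smul_sub]
    exact Submodule.smul_mem _ _ hu
  | h n r a hr hn ha =>
  induction b using homogeneous_induction hg with
  | add u v hu hv =>
    simp only [map_add, LinearMap.add_apply]
    rw [add_sub_add_comm]
    exact Submodule.add_mem _ hu hv
  | smul t u hu =>
    simp only [map_smul, LinearMap.smul_apply]
    rw [← smul_sub]
    exact Submodule.smul_mem _ _ hu
  | h q s b hs hq hb =>
  by_cases h0 : r = 0
  swap
  · rw [A.star_apply_pos g (Nat.pos_of_ne_zero h0) hr ha, map_zero, zero_sub,
      Submodule.neg_mem_iff]
    exact star_mem_Og_right hg.inv _ (phi_mem_Og_inv hg (mem_Og_of_mem_eigen h0 hr hn ha))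
  subst h0
  by_cases h0 : s = 0
  swap
  · rw [A.star_eq_residue hg hn ha]
    exact Submodule.sub_mem _
      (phi_mem_Og_inv hg (residue_mem_Og_of_pos h0 hs hn hq ha hb _ _))
      (star_mem_Og_left hg.inv (phi_mem_Og_inv hg (mem_Og_of_mem_eigen h0 hs hq hb)) _)
  subst h0
  obtain ⟨J, hJ⟩ := A.L_one_locally_nilpotent a
  rw [A.star_eq_residue hg hn ha, A.phi_residue hn hq, A.phi_apply hn, map_smul,
    show n - -1 - 1 = n by ring, ← smul_sub, expL_apply, map_finsum _ (A.exp_finite a),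
    finsum_eq_sum_range (N := J), finsum_eq_sum_range (N := J), ← Finset.sum_sub_distrib]
  · refine Submodule.smul_mem _ _ (Submodule.sum_mem _ fun j _ => ?_)
    rw [map_smul, ← smul_sub]
    have h := residue_sub_star_phi_mem hg.inv (A.L_one_pow_mem hn j) hq
      (L_one_pow_mem_eigen (mem_eigen_inv_zero hg ha) j) (mem_eigen_inv_zero hg hb)
    -- The reflected exponent is the weight of `L(1)^j a` minus one, which puts `φ(b)` on the left
    -- of the product.
    rw [show (2 * n - j - (-1 : ℤ) - 2 - n : ℂ) = ((n - j : ℤ) : ℂ) - 1 by push_cast; ring]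
    exact Submodule.smul_mem _ _ h
  · intro j hj
    rw [hJ j hj, smul_zero, map_zero]
  · intro j hj
    rw [hJ j hj, map_zero, LinearMap.zero_apply, smul_zero]

/-- The product on `A_g(V)` induced by `*_g`. -/
def starQuotient (hg : IsOfFinOrder g) : A.Ag g →ₗ[ℂ] A.Ag g →ₗ[ℂ] A.Ag g :=
  (A.Og g).liftQ
    { toFun := fun u => (A.Og g).mapQ (A.Og g) (A.star g u) fun _ hx => star_mem_Og_right hg u hx
      map_add' := fun u v => by
        ext x
        simp
      map_smul' := fun c u => by
        ext x
        simp }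
    fun u hu => by
      rw [LinearMap.mem_ker]
      ext x
      simpa using star_mem_Og_left hg hu x

theorem starQuotient_mkQ (hg : IsOfFinOrder g) (u v : V) :
    starQuotient hg ((A.Og g).mkQ u) ((A.Og g).mkQ v) = (A.Og g).mkQ (A.star g u v) := rfl

theorem starQuotient_assoc (hg : IsOfFinOrder g) (x y z : A.Ag g) :
    starQuotient hg (starQuotient hg x y) z = starQuotient hg x (starQuotient hg y z) := by
  obtain ⟨a, rfl⟩ := (A.Og g).mkQ_surjective x
  obtain ⟨b, rfl⟩ := (A.Og g).mkQ_surjective y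
  obtain ⟨c, rfl⟩ := (A.Og g).mkQ_surjective z
  simp only [starQuotient_mkQ]
  exact (Submodule.Quotient.eq _).2 (star_assoc_sub_mem hg a b c)

/-- The anti-isomorphism `A_g(V) → A_{g⁻¹}(V)` induced by `φ`. -/
def phiQuotient (hg : IsOfFinOrder g) : A.Ag g ≃ₗ[ℂ] A.Ag g⁻¹ :=
  LinearEquiv.ofLinearMap
    ((A.Og g).mapQ (A.Og g⁻¹) A.phi fun _ hx => phi_mem_Og_inv hg hx)
    ((A.Og g⁻¹).mapQ (A.Og g) A.phi fun x hx => by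
      have := phi_mem_Og_inv hg.inv hx
      rwa [inv_inv] at this)
    (by
      ext x
      simp [phi_phi hg])
    (by
      ext x
      simp [phi_phi hg])

theorem phiQuotient_mkQ (hg : IsOfFinOrder g) (a : V) :
    phiQuotient hg ((A.Og g).mkQ a) = (A.Og g⁻¹).mkQ (A.phi a) := rfl

theorem phiQuotient_starQuotient (hg : IsOfFinOrder g) (x y : A.Ag g) :
    phiQuotient hg (starQuotient hg x y) =
      starQuotient hg.inv (phiQuotient hg y) (phiQuotient hg x) := by
  obtain ⟨a, rfl⟩ := (A.Og g).mkQ_surjective x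
  obtain ⟨b, rfl⟩ := (A.Og g).mkQ_surjective y
  simp only [starQuotient_mkQ, phiQuotient_mkQ]
  exact (Submodule.Quotient.eq _).2 (phi_star_sub_mem hg a b)

end VertexOperatorAlgebra

end

theorem theorem2p4 {V : Type*} [AddCommGroup V] [Module ℂ V] (A : VertexOperatorAlgebra V)
    (g : A.Aut) (hg : IsOfFinOrder g) :
    -- the products induced by `*_g` on `A_g(V)` and by `*_{g⁻¹}` on `A_{g⁻¹}(V)`
    ∃ (μ : A.Ag g →ₗ[ℂ] A.Ag g →ₗ[ℂ] A.Ag g)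
      (μ' : A.Ag g⁻¹ →ₗ[ℂ] A.Ag g⁻¹ →ₗ[ℂ] A.Ag g⁻¹),
      (∀ u v : V, μ ((A.Og g).mkQ u) ((A.Og g).mkQ v) = (A.Og g).mkQ (A.star g u v)) ∧
      (∀ u v : V, μ' ((A.Og g⁻¹).mkQ u) ((A.Og g⁻¹).mkQ v) =
        (A.Og g⁻¹).mkQ (A.star g⁻¹ u v)) ∧
      -- (i) they are associative
      (∀ x y z : A.Ag g, μ (μ x y) z = μ x (μ y z)) ∧
      (∀ x y z : A.Ag g⁻¹, μ' (μ' x y) z = μ' x (μ' y z)) ∧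
      -- (ii) `φ` induces an anti-isomorphism
      (∃ Φ : A.Ag g ≃ₗ[ℂ] A.Ag g⁻¹,
        (∀ a : V, Φ ((A.Og g).mkQ a) = (A.Og g⁻¹).mkQ (A.phi a)) ∧
        (∀ x y : A.Ag g, Φ (μ x y) = μ' (Φ y) (Φ x))) ∧
      -- (iii) the vacuum is an identity and `ω` is central modulo `O_g(V)`
      (∀ x : V, A.star g A.vacuum x ≡ x [SMOD A.Og g] ∧ A.star g x A.vacuum ≡ x [SMOD A.Og g]) ∧
      (∀ x : V, A.star g A.omega x ≡ A.star g x A.omega [SMOD A.Og g]) := by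
  exact ⟨VertexOperatorAlgebra.starQuotient hg, VertexOperatorAlgebra.starQuotient hg.inv,
    VertexOperatorAlgebra.starQuotient_mkQ hg, VertexOperatorAlgebra.starQuotient_mkQ hg.inv,
    VertexOperatorAlgebra.starQuotient_assoc hg, VertexOperatorAlgebra.starQuotient_assoc hg.inv,
    ⟨VertexOperatorAlgebra.phiQuotient hg, VertexOperatorAlgebra.phiQuotient_mkQ hg,
      VertexOperatorAlgebra.phiQuotient_starQuotient hg⟩,
    fun x => ⟨by rw [VertexOperatorAlgebra.vacuum_star hg],
      SModEq.sub_mem.2 (VertexOperatorAlgebra.star_vacuum_sub_mem hg x)⟩,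
    fun x => SModEq.sub_mem.2 (VertexOperatorAlgebra.omega_star_sub_mem hg x)⟩
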